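/- Let $n\ge 1$, $s\in(0,1)$, and let $\Omega\subset\mathbb R^n$ be a bounded open set. Let $$|v|_{s}^2=\int_{\mathbb R^n}\int_{\mathbb R^n}\frac{|v(x)-v(y)|^2}{|x-y|^{n+2s}}\,dy\,dx,\qquad \|v\|_{H^s}^2=\|v\|_{L^2}^2+|v|_s^2,$$ let $H^s_\Omega(\mathbb R^n)=\{v\in L^2(\mathbb R^n):|v|_s<\infty,\ v=0\text{ a.e. in }\mathbb R^n\setminus\Omega\}$ (real-valued functions), and let $\|v\|_{H^s_\Omega}=|v|_s$. Put $$C_{n,s}=\frac{4^s\,\Gamma(s+\frac n2)}{\pi^{n/2}|\Gamma(-s)|},\qquad C_\omega=\frac{s}{\Gamma(1-s)}\Big(2\sin\big(\tfrac{\pi s}{2}\big)\int_{|\theta|=1,\ \theta_1\ge 0}|\theta_1|^{s+1}\,d\theta\Big)^{-1},$$ $$\omega(x,y)=C_\omega|x-y|^{-(n+s)},\qquad \alpha(x,y)=\frac{y-x}{|y-x|},\qquad \mathcal G_\omega u(x)=\int_{\mathbb R^n}\omega(x,y)\,(u(y)-u(x))\,\alpha(x,y)\,dy,$$ where the singular integral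 $\mathcal G_\omega u$ is the limit in $L^2(\mathbb R^n;\mathbb R^n)$, as $\varepsilon\downarrow0$, of the integrals over $\{|y-x|>\varepsilon\}$. **(a)** For every $u\in H^s_\Omega(\mathbb R^n)$ the gradient $\mathcal G_\omega u$ exists and lies in $L^2$, and it equals the integral above at a.e. $x$ at which that integral converges absolutely. There is $K>0$, depending only on $n,s,\Omega$, with $\|u\|_{H^s}\le K\,\|u\|_{H^s_\Omega}$ for all $u\in H^s_\Omega(\mathbb R^n)$. Let $A:\mathbb R^n\to\mathbb R^{n\times n}$ be measurable and symmetric, with $0<\lambda_{\min}\le\lambda_{\max}<\infty$ such that $\lambda_{\min}|\mathbf v|^2\le \mathbf v\cdot A(x)\mathbf v\le\lambda_{\max}|\mathbf v|^2$ for all $x,\mathbf v\in\mathbb R^n$, and let $$\mathcal B_{\omega;A}(u,v)=\int_{\mathbb R^n}\mathcal G_\omega u(x)\cdot A(x)\,\mathcal G_\omega v(x)\,dx,\qquad |||v|||_A^2=\mathcal B_{\omega;A}(v,v).$$ Let $V^A_\Omega$ be the set of all $v\in L^2(\mathbb R^n)$ for which $\mathcal G_\omega v$ exists, $|||v|||_A<\infty$,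 and $v=0$ a.e. in $\mathbb R^n\setminus\Omega$. Then, with $$C_{\rm coer}=\frac{C_{n,s}}2\lambda_{\min}>0,\qquad C_{\rm cont}=\frac{C_{n,s}}2\lambda_{\max}:$$ **(b)** $\mathcal B_{\omega;A}$ is a well-defined bilinear form on $H^s_\Omega(\mathbb R^n)$ (its integrand is integrable), and for all $u,v\in H^s_\Omega(\mathbb R^n)$ $$|\mathcal B_{\omega;A}(u,v)|\le C_{\rm cont}\,\|u\|_{H^s_\Omega}\|v\|_{H^s_\Omega},\qquad \mathcal B_{\omega;A}(u,u)\ge C_{\rm coer}\,\|u\|_{H^s_\Omega}^2 .$$ **(c)** $V^A_\Omega=H^s_\Omega(\mathbb R^n)$, and the anisotropic fractional Poisson problem is well-posed there: let $\mathcal F$ be a linear functional on $H^s_\Omega(\mathbb R^n)$ that is bounded with respect to one of the norms $|||\cdot|||_A$, $\|\cdot\|_{H^s_\Omega}$, $\|\cdot\|_{H^s}$, say $|\mathcal F(v)|\le M\|v\|$ for all $v$, where $M\ge 0$. Then there is exactly one $u\in H^s_\Omega(\mathbb R^n)$ with $$\mathcal B_{\omega;A}(u,v)=\mathcal F(v)\qquad\text{for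 all } v\in H^s_\Omega(\mathbb R^n),$$ and in that norm $\|u\|\le C M$ with $C=1$, $C=C_{\rm coer}^{-1}$, $C=K^2C_{\rm coer}^{-1}$, respectively. -/

import Mathlib

open MeasureTheory Filter Topology
open scoped ENNReal

namespace FracAniso

noncomputable section

/-- Euclidean space `ℝⁿ`. -/
abbrev E (n : ℕ) : Type := EuclideanSpace ℝ (Fin n)

/-- The space `L²(ℝⁿ)` of (classes of) real-valued functions. -/
abbrev L2 (n : ℕ) : Type := Lp ℝ 2 (volume : Measure (E n))

/-! ### Fractional Sobolev spaces -/

/-- The squared Gagliardo seminorm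
`∫ ∫ |u(x) - u(y)|² / |x - y|^(n + 2s) dy dx`, with values in `[0, ∞]`. -/
def gagliardo {n : ℕ} (s : ℝ) (u : E n → ℝ) : ℝ≥0∞ :=
  ∫⁻ x, ∫⁻ y, ENNReal.ofReal (|u x - u y| ^ 2 / ‖x - y‖ ^ ((n : ℝ) + 2 * s))

theorem gagliardo_congr {n : ℕ} (s : ℝ) {u v : E n → ℝ} (h : u =ᵐ[volume] v) :
    gagliardo s u = gagliardo s v := by
  refine lintegral_congr_ae ?_
  filter_upwards [h] with x hx
  refine lintegral_congr_ae ?_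
  filter_upwards [h] with y hy
  rw [hx, hy]

theorem gagliardo_zero {n : ℕ} (s : ℝ) : gagliardo s (fun _ : E n => (0 : ℝ)) = 0 := by
  simp [gagliardo]

theorem gagliardo_smul_le {n : ℕ} (s c : ℝ) (u : E n → ℝ) :
    gagliardo s (fun x => c * u x) = ENNReal.ofReal (c ^ 2) * gagliardo s u := by
  unfold gagliardo
  rw [← lintegral_const_mul' _ _ ENNReal.ofReal_ne_top]
  refine lintegral_congr fun x => ?_
  rw [← lintegral_const_mul' _ _ ENNReal.ofReal_ne_top]
  refine lintegral_congr fun y => ?_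
  rw [← ENNReal.ofReal_mul (sq_nonneg c)]
  congr 1
  simp only [sq_abs]
  ring

theorem ofReal_add_sq_div_le (a b r : ℝ) (hr : 0 ≤ r) :
    ENNReal.ofReal (|a + b| ^ 2 / r) ≤
      2 * ENNReal.ofReal (|a| ^ 2 / r) + 2 * ENNReal.ofReal (|b| ^ 2 / r) := by
  have h2 : (2 : ℝ≥0∞) = ENNReal.ofReal 2 := by simp
  have ha : 0 ≤ |a| ^ 2 / r := div_nonneg (sq_nonneg _) hr
  have hb : 0 ≤ |b| ^ 2 / r := div_nonneg (sq_nonneg _) hr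
  rw [h2, ← ENNReal.ofReal_mul (by norm_num), ← ENNReal.ofReal_mul (by norm_num),
    ← ENNReal.ofReal_add (by linarith) (by linarith)]
  refine ENNReal.ofReal_le_ofReal ?_
  rw [← mul_div_assoc, ← mul_div_assoc, ← add_div]
  refine div_le_div_of_nonneg_right ?_ hr
  simp only [sq_abs]
  nlinarith [sq_nonneg (a - b)]

theorem lintegral_lintegral_le_add {X : Type*} [MeasurableSpace X] (μ : Measure X) [SFinite μ]
    (f g h : X → X → ℝ≥0∞) (hg : Measurable (Function.uncurry g))
    (H : ∀ x y, f x y ≤ 2 * g x y + 2 * h x y) :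
    ∫⁻ x, ∫⁻ y, f x y ∂μ ∂μ ≤
      2 * (∫⁻ x, ∫⁻ y, g x y ∂μ ∂μ) + 2 * (∫⁻ x, ∫⁻ y, h x y ∂μ ∂μ) := by
  have hg1 : ∀ x, Measurable (g x) := fun x => hg.comp measurable_prodMk_left
  have hg2 : Measurable (fun x => ∫⁻ y, g x y ∂μ) := Measurable.lintegral_prod_right hg
  have h2 : (2 : ℝ≥0∞) ≠ ⊤ := ENNReal.ofNat_ne_top
  calc ∫⁻ x, ∫⁻ y, f x y ∂μ ∂μ
      ≤ ∫⁻ x, (2 * (∫⁻ y, g x y ∂μ) + 2 * ∫⁻ y, h x y ∂μ) ∂μ := by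
        refine lintegral_mono fun x => ?_
        calc ∫⁻ y, f x y ∂μ ≤ ∫⁻ y, (2 * g x y + 2 * h x y) ∂μ := lintegral_mono (H x)
          _ = _ := by
            rw [lintegral_add_left ((hg1 x).const_mul 2), lintegral_const_mul' _ _ h2,
              lintegral_const_mul' _ _ h2]
    _ = _ := by
      rw [lintegral_add_left (hg2.const_mul 2), lintegral_const_mul' _ _ h2,
        lintegral_const_mul' _ _ h2]

theorem gagliardo_add_le {n : ℕ} (s : ℝ) {u v : E n → ℝ} (hu : Measurable u) :
    gagliardo s (fun x => u x + v x) ≤ 2 * gagliardo s u + 2 * gagliardo s v := by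
  refine lintegral_lintegral_le_add volume _ _ _ ?_ ?_
  · have h1 : Measurable (fun p : E n × E n => u p.1) := hu.comp measurable_fst
    have h2 : Measurable (fun p : E n × E n => u p.2) := hu.comp measurable_snd
    have h3 : Measurable (fun p : E n × E n => |u p.1 - u p.2|) := (h1.sub h2).norm
    have h4 : Measurable (fun p : E n × E n => ‖p.1 - p.2‖) :=
      (measurable_fst.sub measurable_snd).norm
    exact ((h3.pow_const 2).div (h4.pow_const _)).ennreal_ofReal
  · intro x y
    have h := ofReal_add_sq_div_le (u x - u y) (v x - v y) (‖x - y‖ ^ ((n : ℝ) + 2 * s))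
      (Real.rpow_nonneg (norm_nonneg _) _)
    rwa [show u x - u y + (v x - v y) = u x + v x - (u y + v y) by ring] at h

/-- The space `H^s_Ω(ℝⁿ) = {v ∈ H^s(ℝⁿ) : v = 0 a.e. outside Ω}`, where `H^s(ℝⁿ)` is the space
of all `v ∈ L²(ℝⁿ)` with finite Gagliardo seminorm. -/
def HsOmega {n : ℕ} (s : ℝ) (Ω : Set (E n)) : Submodule ℝ (L2 n) where
  carrier := {v | gagliardo s v < ⊤ ∧ ∀ᵐ x, x ∉ Ω → v x = 0}
  add_mem' := by
    rintro u v ⟨hu, hu0⟩ ⟨hv, hv0⟩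
    have h := Lp.coeFn_add u v
    refine ⟨?_, ?_⟩
    · rw [gagliardo_congr s h]
      refine (gagliardo_add_le s (Lp.stronglyMeasurable u).measurable).trans_lt ?_
      exact ENNReal.add_lt_top.2 ⟨ENNReal.mul_lt_top (by simp) hu, ENNReal.mul_lt_top (by simp) hv⟩
    · filter_upwards [h, hu0, hv0] with x hx h1 h2 hΩ
      rw [hx, Pi.add_apply, h1 hΩ, h2 hΩ, add_zero]
  zero_mem' := by
    have h := Lp.coeFn_zero ℝ 2 (volume : Measure (E n))
    refine ⟨?_, ?_⟩
    · rw [gagliardo_congr s h]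
      exact (gagliardo_zero (n := n) s).trans_lt ENNReal.zero_lt_top
    · filter_upwards [h] with x hx _
      rw [hx, Pi.zero_apply]
  smul_mem' := by
    rintro c v ⟨hv, hv0⟩
    have h := Lp.coeFn_smul c v
    refine ⟨?_, ?_⟩
    · rw [gagliardo_congr s h]
      exact (gagliardo_smul_le s c v).trans_lt (ENNReal.mul_lt_top ENNReal.ofReal_lt_top hv)
    · filter_upwards [h, hv0] with x hx h1 hΩ
      rw [hx, Pi.smul_apply, h1 hΩ, smul_zero]

/-- The norm of `H^s_Ω(ℝⁿ)`: the Gagliardo seminorm. -/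
def hsOmegaNorm {n : ℕ} (s : ℝ) (v : L2 n) : ℝ := √(gagliardo s v).toReal

/-- The full norm of `H^s(ℝⁿ)`. -/
def hsNorm {n : ℕ} (s : ℝ) (v : L2 n) : ℝ := √(‖v‖ ^ 2 + (gagliardo s v).toReal)

/-! ### Weighted nonlocal gradient and the anisotropic form -/

/-- The nonlocal gradient `∫ ω(x,y) (u(y) - u(x)) α(x,y) dy`, the integral being restricted to
`|y - x| > ε`. -/
def truncatedGradient {n : ℕ} (ω : E n → E n → ℝ) (α : E n → E n → E n) (ε : ℝ) (u : E n → ℝ)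
    (x : E n) : E n :=
  ∫ y in {y | ε < ‖y - x‖}, (ω x y * (u y - u x)) • α x y

/-- `G` is the `ω`-weighted gradient of `u`, i.e. `G(x) = ∫ ω(x,y) (u(y) - u(x)) α(x,y) dy`,
the singular integral being the limit in `L²(ℝⁿ; ℝⁿ)`, as `ε ↓ 0`, of the integrals over
`|y - x| > ε`. (For a general `u ∈ H^s` the integral need not converge absolutely.) -/
def IsWeightedGradient {n : ℕ} (ω : E n → E n → ℝ) (α : E n → E n → E n) (u : E n → ℝ)
    (G : E n → E n) : Prop :=
  AEStronglyMeasurable G volume ∧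
    Tendsto (fun ε : ℝ => eLpNorm (fun x => truncatedGradient ω α ε u x - G x) 2 volume)
      (𝓝[>] 0) (𝓝 0)

open Classical in
/-- The `ω`-weighted gradient of `u` (with value `0` if `u` has none). -/
def weightedGradient {n : ℕ} (ω : E n → E n → ℝ) (α : E n → E n → E n) (u : E n → ℝ) :
    E n → E n :=
  if h : ∃ G, IsWeightedGradient ω α u G then h.choose else 0

/-- `A` is a measurable, symmetric, elliptic tensor field with ellipticity bounds
`0 < lmin ≤ lmax`; boundedness is the upper bound. -/
structure IsDiffusionTensor {n : ℕ} (A : E n → Matrix (Fin n) (Fin n) ℝ) (lmin lmax : ℝ) :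
    Prop where
  measurable : ∀ i j, AEMeasurable (fun x => A x i j) volume
  symm : ∀ x, (A x).IsSymm
  pos : 0 < lmin
  le : lmin ≤ lmax
  lower : ∀ x v : E n, lmin * ‖v‖ ^ 2 ≤ inner ℝ v ((A x).toEuclideanLin v)
  upper : ∀ x v : E n, inner ℝ v ((A x).toEuclideanLin v) ≤ lmax * ‖v‖ ^ 2

/-- The integrand `G_ω u(x) · A(x) G_ω v(x)`. -/
def formIntegrand {n : ℕ} (ω : E n → E n → ℝ) (α : E n → E n → E n)
    (A : E n → Matrix (Fin n) (Fin n) ℝ) (u v : E n → ℝ) (x : E n) : ℝ :=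
  inner ℝ (weightedGradient ω α u x) ((A x).toEuclideanLin (weightedGradient ω α v x))

/-- The anisotropic form `B_{ω;A}(u,v) = ∫ G_ω u(x) · A(x) G_ω v(x) dx`. -/
def anisoForm {n : ℕ} (ω : E n → E n → ℝ) (α : E n → E n → E n)
    (A : E n → Matrix (Fin n) (Fin n) ℝ) (u v : E n → ℝ) : ℝ :=
  ∫ x, formIntegrand ω α A u v x

/-- The squared anisotropic energy `|||v|||_A² = ∫ G_ω v(x) · A(x) G_ω v(x) dx` in `[0, ∞]`. -/
def anisoEnergy {n : ℕ} (ω : E n → E n → ℝ) (α : E n → E n → E n)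
    (A : E n → Matrix (Fin n) (Fin n) ℝ) (v : E n → ℝ) : ℝ≥0∞ :=
  ∫⁻ x, ENNReal.ofReal (formIntegrand ω α A v v x)

/-- The anisotropic energy norm `|||v|||_A`. -/
def anisoEnergyNorm {n : ℕ} (ω : E n → E n → ℝ) (α : E n → E n → E n)
    (A : E n → Matrix (Fin n) (Fin n) ℝ) (v : L2 n) : ℝ :=
  √(anisoEnergy ω α A v).toReal

/-- The anisotropic energy space `V^A_Ω(ℝⁿ)`: all `v ∈ L²(ℝⁿ)` that have a weighted gradient, with
`|||v|||_A < ∞` and `v = 0` a.e. outside `Ω`. -/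
def energySpace {n : ℕ} (ω : E n → E n → ℝ) (α : E n → E n → E n)
    (A : E n → Matrix (Fin n) (Fin n) ℝ) (Ω : Set (E n)) : Set (L2 n) :=
  {v | (∃ G, IsWeightedGradient ω α v G) ∧ anisoEnergy ω α A v < ⊤ ∧ ∀ᵐ x, x ∉ Ω → v x = 0}

/-- Well-posedness, in the norm `N` of the space `V`, of the problem: given a bounded linear
functional `F` on `V`, find `u ∈ V` with `B(u,v) = F(v)` for all `v ∈ V`. There is a solution, it
is unique, and its norm is at most `C` times (any bound for) the norm of `F`. -/
def WellPosed {n : ℕ} (V : Submodule ℝ (L2 n)) (N : L2 n → ℝ) (B : L2 n → L2 n → ℝ) (C : ℝ) :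
    Prop :=
  ∀ (F : V →ₗ[ℝ] ℝ) (M : ℝ), 0 ≤ M → (∀ v : V, |F v| ≤ M * N v) →
    ∃ u : V, (∀ v : V, B u v = F v) ∧ (∀ u' : V, (∀ v : V, B u' v = F v) → u' = u) ∧
      N u ≤ C * M

/-! ### The fractional weight and kernel -/

/-- `C_{n,s} = 4^s Γ(s + n/2) / (π^(n/2) |Γ(-s)|)`. -/
def Cns (n : ℕ) (s : ℝ) : ℝ :=
  4 ^ s * Real.Gamma (s + n / 2) / (Real.pi ^ ((n : ℝ) / 2) * |Real.Gamma (-s)|)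

/-- The normalizing constant
`C_ω = (s / Γ(1-s)) / (2 sin(πs/2) ∫_{|θ| = 1, θ₁ ≥ 0} |θ₁|^(s+1) dθ)`
(`dθ` is the surface measure of the unit sphere; counting measure on `{-1, 1}` if `n = 1`). -/
def Comega (n : ℕ) [NeZero n] (s : ℝ) : ℝ :=
  (s / Real.Gamma (1 - s)) /
    (2 * Real.sin (Real.pi * s / 2) *
      ∫ θ in {θ : Metric.sphere (0 : E n) 1 | 0 ≤ (θ : E n) 0},
        |(θ : E n) 0| ^ (s + 1) ∂((volume : Measure (E n)).toSphere))

/-- The weight `ω(x,y) = C_ω |x - y|^(-(n+s))`. -/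
def fracWeight (n : ℕ) [NeZero n] (s : ℝ) (x y : E n) : ℝ :=
  Comega n s * ‖x - y‖ ^ (-((n : ℝ) + s))

/-- The kernel `α(x,y) = (y - x) / |y - x|`. -/
def fracKernel (n : ℕ) (x y : E n) : E n := ‖y - x‖⁻¹ • (y - x)

end

end FracAniso

open MeasureTheory Filter Topology
open scoped ENNReal

namespace FracAniso

noncomputable section

/-! ### One-dimensional Gamma and sine integrals. -/

section

open Set Real

/-! Everything rests on one identity: on `H^s_Ω`, the squared `L²` norm of the fractional gradient
is `C_{n,s}/2` times the squared Gagliardo seminorm.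

The kernel `k` of the gradient is odd, so the gradient truncated at `ε` is a convolution, up to
sign, with an odd integrable kernel. On the Fourier side it multiplies by `i σ_ε(ξ)`, where `σ_ε(ξ)`
is the integral of `sin(2π ξ·z) k(z)` over `|z| > ε`. These symbols converge to a limit `σ(ξ)` and
are bounded by a constant times `|ξ|^s`, uniformly in `ε`. Scaling and rotation reduce `σ` to a
single frequency, where `C_ω` is exactly the constant that gives `|σ(ξ)| = (2π|ξ|)^s`
(`norm_gradSymbol`). The seminorm is `2 / C_{n,s}` times the integral of `(2π|ξ|)^(2s) |û(ξ)|²`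
(`gagliardo_eq_lintegral_fourier`), and Plancherel yields the identity (`memLp_fracGrad`). Because
`Ω` is bounded, all functions involved are in `L¹ ∩ L²`, so the classical Fourier integral suffices.

Dominated convergence on the Fourier side gives existence of the gradient
(`exists_isWeightedGradient`). Fatou gives the converse, that a function with a gradient has finite
seminorm (`IsWeightedGradient.gagliardo_lt_top`), hence `V^A_Ω = H^s_Ω`. Ellipticity of `A` turns
the identity into continuity and coercivity with the stated constants.

For well-posedness, a Poincaré inequality (`exists_norm_sq_le_gagliardo`) makes the gradient
injective with closed range in `L²` (`isClosed_range_gradLp`), and Lax–Milgram is applied on that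
range (`existsUnique_of_coercive`). Testing the equation with its own solution gives the three
stability bounds. -/

/-- A nonintegrable function has Bochner integral `0` by convention, so a nonzero value already
implies integrability. This moves closed formulas to `lintegral`, where Tonelli applies freely. -/
theorem lintegral_ofReal_of_integral_eq {α : Type*} {m : MeasurableSpace α} {μ : Measure α}
    {f : α → ℝ} {c : ℝ} (h0 : 0 ≤ᵐ[μ] f) (h : ∫ x, f x ∂μ = c) (hc : c ≠ 0) :
    ∫⁻ x, ENNReal.ofReal (f x) ∂μ = ENNReal.ofReal c := by
  have hf : Integrable f μ := by
    by_contra hf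
    exact hc (h ▸ integral_undef hf)
  rw [← h, ofReal_integral_eq_lintegral_ofReal hf h0]

theorem lintegral_rpow_mul_exp_neg_mul {a r : ℝ} (ha : 0 < a) (hr : 0 < r) :
    ∫⁻ t in Ioi (0 : ℝ), ENNReal.ofReal (t ^ (a - 1) * rexp (-(r * t))) =
      ENNReal.ofReal (r ^ (-a) * Gamma a) := by
  refine lintegral_ofReal_of_integral_eq ?_ ?_ ?_
  · filter_upwards [self_mem_ae_restrict measurableSet_Ioi] with t (ht : 0 < t)
    simp only [Pi.zero_apply]; positivity
  · rw [integral_rpow_mul_exp_neg_mul_Ioi ha hr, one_div, inv_rpow hr.le, rpow_neg hr.le]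
  · have := Gamma_pos_of_pos ha
    positivity

/-- The substitution `t ↦ 1/t` turns this into a Gamma integral. -/
theorem integral_rpow_mul_exp_neg_div {s w : ℝ} (hs1 : s < 1) (hw : 0 < w) :
    ∫ t in Ioi (0 : ℝ), t ^ (s - 2) * rexp (-(w / t)) = w ^ (s - 1) * Gamma (1 - s) := by
  have h := integral_comp_rpow_Ioi (fun y : ℝ => y ^ (-s) * rexp (-(w * y)))
    (p := -1) (by norm_num)
  have h2 := integral_rpow_mul_exp_neg_mul_Ioi (a := 1 - s) (r := w) (by linarith) hw
  rw [show (1 : ℝ) - s - 1 = -s by ring, one_div, inv_rpow hw.le, ← rpow_neg hw.le,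
    show -(1 - s) = s - 1 by ring] at h2
  rw [← h2, ← h]
  refine setIntegral_congr_fun measurableSet_Ioi fun t (ht : 0 < t) => ?_
  simp only [abs_neg, abs_one, one_mul, smul_eq_mul]
  rw [← rpow_mul ht.le, ← mul_assoc, ← rpow_add ht, rpow_neg_one, div_eq_mul_inv]
  congr 2; ring

/-- Write `1 - exp(-a/t)` as the integral of `exp(-w/t)/t` over `0 < w ≤ a` and integrate in `t`
before `w`. -/
theorem lintegral_rpow_mul_one_sub_exp_neg_div {s a : ℝ} (hs0 : 0 < s) (hs1 : s < 1)
    (ha : 0 ≤ a) :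
    ∫⁻ t in Ioi (0 : ℝ), ENNReal.ofReal (t ^ (s - 1) * (1 - rexp (-(a / t)))) =
      ENNReal.ofReal (a ^ s * (Gamma (1 - s) / s)) := by
  have hG : 0 < Gamma (1 - s) := Gamma_pos_of_pos (by linarith)
  have key : ∀ t ∈ Ioi (0 : ℝ), ENNReal.ofReal (t ^ (s - 1) * (1 - rexp (-(a / t)))) =
      ∫⁻ w in Ioc 0 a, ENNReal.ofReal (t ^ (s - 2) * rexp (-(w / t))) := by
    intro t (ht : 0 < t)
    have hint : IntervalIntegrable (fun w => t ^ (s - 2) * rexp (-(w / t))) volume 0 a :=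
      Continuous.intervalIntegrable (by fun_prop) _ _
    have hd : ∀ w ∈ Set.uIcc 0 a, HasDerivAt (fun w => - t ^ (s - 1) * rexp (-(w / t)))
        (t ^ (s - 2) * rexp (-(w / t))) w := by
      intro w _
      have h1 : HasDerivAt (fun w : ℝ => -(w / t)) (-(1 / t)) w :=
        ((hasDerivAt_id w).div_const t).neg
      convert! (h1.exp.const_mul (- t ^ (s - 1))) using 1
      rw [show s - 1 = (s - 2) + 1 by ring, rpow_add_one ht.ne']
      field_simp
    have h := intervalIntegral.integral_eq_sub_of_hasDerivAt hd hint
    rw [intervalIntegral.integral_of_le ha] at h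
    rw [← ofReal_integral_eq_lintegral_ofReal hint.1 (ae_of_all _ fun w => by
      simp only [Pi.zero_apply]; positivity), h]
    congr 1
    simp
    ring
  rw [setLIntegral_congr_fun measurableSet_Ioi key, lintegral_lintegral_swap]
  · have : ∀ w ∈ Ioc 0 a,
        ∫⁻ t in Ioi (0 : ℝ), ENNReal.ofReal (t ^ (s - 2) * rexp (-(w / t))) =
          ENNReal.ofReal (w ^ (s - 1) * Gamma (1 - s)) := by
      intro w hw
      refine lintegral_ofReal_of_integral_eq ?_ (integral_rpow_mul_exp_neg_div hs1 hw.1) ?_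
      · filter_upwards [self_mem_ae_restrict measurableSet_Ioi] with t (ht : 0 < t)
        simp only [Pi.zero_apply]; positivity
      · have := rpow_pos_of_pos hw.1 (s - 1)
        positivity
    rw [setLIntegral_congr_fun measurableSet_Ioc this]
    have hint : IntervalIntegrable (fun w => w ^ (s - 1) * Gamma (1 - s)) volume 0 a :=
      (intervalIntegral.intervalIntegrable_rpow' (by linarith)).mul_const _
    rw [← ofReal_integral_eq_lintegral_ofReal hint.1, ← intervalIntegral.integral_of_le ha,
      intervalIntegral.integral_mul_const, integral_rpow (Or.inl (by linarith))]
    · congr 1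
      rw [sub_add_cancel, zero_rpow hs0.ne']
      ring
    · filter_upwards [self_mem_ae_restrict measurableSet_Ioc] with w hw
      have := rpow_nonneg hw.1.le (s - 1)
      simp only [Pi.zero_apply]; positivity
  · refine Measurable.aemeasurable ?_
    simp only [Function.uncurry_def]
    fun_prop

/-- With `1/(1+t²)` written as a Laplace integral, Tonelli leaves `Γ((1+s)/2) Γ((1-s)/2) / 2`, and
the reflection formula gives the cosine. -/
theorem integral_rpow_div_one_add_sq {s : ℝ} (hs0 : 0 < s) (hs1 : s < 1) :
    ∫ t in Ioi (0 : ℝ), t ^ s / (1 + t ^ 2) = π / (2 * cos (π * s / 2)) := by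
  have hg1 : 0 < Gamma ((s + 1) / 2) := Gamma_pos_of_pos (by linarith)
  have hg2 : 0 < Gamma ((1 - s) / 2) := Gamma_pos_of_pos (by linarith)
  have hcos : 0 < cos (π * s / 2) := by
    apply cos_pos_of_mem_Ioo
    constructor <;> nlinarith [pi_pos]
  have hL : ∫⁻ t in Ioi (0 : ℝ), ENNReal.ofReal (t ^ s / (1 + t ^ 2)) =
      ENNReal.ofReal (π / (2 * cos (π * s / 2))) := by
    have key : ∀ t ∈ Ioi (0 : ℝ), ENNReal.ofReal (t ^ s / (1 + t ^ 2)) =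
        ∫⁻ w in Ioi (0 : ℝ), ENNReal.ofReal (t ^ s * rexp (-((1 + t ^ 2) * w))) := by
      intro t (ht : 0 < t)
      symm
      refine lintegral_ofReal_of_integral_eq (ae_of_all _ fun w => ?_) ?_ ?_
      · simp only [Pi.zero_apply]; positivity
      · have := integral_rpow_mul_exp_neg_mul_Ioi (a := 1) (r := 1 + t ^ 2) one_pos (by positivity)
        simp only [sub_self, rpow_zero, one_mul, rpow_one, Gamma_one, mul_one] at this
        rw [integral_const_mul, this, mul_one_div]
      · positivity
    rw [setLIntegral_congr_fun measurableSet_Ioi key, lintegral_lintegral_swap (by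
      refine Measurable.aemeasurable ?_
      simp only [Function.uncurry_def]
      fun_prop)]
    have h2 : ∀ w ∈ Ioi (0 : ℝ),
        ∫⁻ t in Ioi (0 : ℝ), ENNReal.ofReal (t ^ s * rexp (-((1 + t ^ 2) * w))) =
        ENNReal.ofReal (1 / 2 * Gamma ((s + 1) / 2) *
          (w ^ ((1 - s) / 2 - 1) * rexp (-(1 * w)))) := by
      intro w (hw : 0 < w)
      refine lintegral_ofReal_of_integral_eq ?_ ?_ ?_
      · filter_upwards [self_mem_ae_restrict measurableSet_Ioi] with t (ht : 0 < t)
        simp only [Pi.zero_apply]; positivity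
      · have := integral_rpow_mul_exp_neg_mul_rpow (p := 2) (q := s) (b := w) two_pos
          (by linarith) hw
        calc _ = ∫ t in Ioi (0 : ℝ), rexp (-w) * (t ^ s * rexp (-w * t ^ (2 : ℝ))) := by
              refine setIntegral_congr_fun measurableSet_Ioi fun t _ => ?_
              simp only [rpow_ofNat]
              rw [mul_left_comm, ← exp_add]
              congr 2; ring
          _ = _ := by
              rw [integral_const_mul, this, show -(s + 1) / 2 = (1 - s) / 2 - 1 by ring, one_mul]
              ring
      · positivity
    rw [setLIntegral_congr_fun measurableSet_Ioi h2]
    refine lintegral_ofReal_of_integral_eq ?_ ?_ ?_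
    · filter_upwards [self_mem_ae_restrict measurableSet_Ioi] with t (ht : 0 < t)
      simp only [Pi.zero_apply]; positivity
    · rw [integral_const_mul, integral_rpow_mul_exp_neg_mul_Ioi (by linarith) one_pos, div_one,
        one_rpow, one_mul, mul_assoc]
      have := Gamma_mul_Gamma_one_sub ((s + 1) / 2)
      rw [show 1 - (s + 1) / 2 = (1 - s) / 2 by ring,
        show π * ((s + 1) / 2) = π * s / 2 + π / 2 by ring, sin_add_pi_div_two] at this
      rw [this]
      field_simp
    · positivity
  rw [integral_eq_lintegral_of_nonneg_ae, hL, ENNReal.toReal_ofReal (by positivity)]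
  · filter_upwards [self_mem_ae_restrict measurableSet_Ioi] with t (ht : 0 < t)
    simp only [Pi.zero_apply]; positivity
  · exact Measurable.aestronglyMeasurable (by fun_prop)

theorem integral_sin_mul_exp_neg_mul {t : ℝ} (ht : 0 < t) :
    ∫ x in Ioi (0 : ℝ), sin x * rexp (-(t * x)) = 1 / (1 + t ^ 2) := by
  have h := integral_exp_mul_complex_Ioi (a := -t + Complex.I) (by simpa using ht) 0
  have hint := integrableOn_exp_mul_complex_Ioi (a := -t + Complex.I) (by simpa using ht) 0
  have h2 : ∫ x in Ioi (0 : ℝ), (Complex.exp ((-t + Complex.I) * x)).im =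
      (∫ x in Ioi (0 : ℝ), Complex.exp ((-t + Complex.I) * x)).im :=
    integral_im hint
  rw [h] at h2
  have h3 : ∀ x : ℝ, (Complex.exp ((-t + Complex.I) * x)).im = sin x * rexp (-(t * x)) := by
    intro x
    rw [Complex.exp_im]
    simp [mul_comm]
  simp only [h3] at h2
  rw [h2]
  simp [Complex.div_im, Complex.normSq_apply]
  ring

/-- Near `0` use `|sin x| ≤ x`, which needs `s < 1`; at infinity use `|sin x| ≤ 1`, which needs `s >
0`. -/
theorem integrableOn_sin_mul_rpow {s : ℝ} (hs0 : 0 < s) (hs1 : s < 1) :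
    IntegrableOn (fun x => sin x * x ^ (-(1 + s))) (Ioi (0 : ℝ)) := by
  rw [← Ioc_union_Ioi_eq_Ioi zero_le_one]
  refine IntegrableOn.union ?_ ?_
  · have h : IntegrableOn (fun x : ℝ => x ^ (-s)) (Ioc 0 1) :=
      (intervalIntegral.intervalIntegrable_rpow' (by linarith : -1 < -s) (a := 0) (b := 1)).1
    refine h.mono' (Measurable.aestronglyMeasurable (by fun_prop)) ?_
    filter_upwards [self_mem_ae_restrict measurableSet_Ioc] with x hx
    have hx0 : 0 < x := hx.1
    rw [norm_mul, norm_eq_abs, norm_eq_abs, abs_of_pos (rpow_pos_of_pos hx0 _)]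
    calc |sin x| * x ^ (-(1 + s)) ≤ x * x ^ (-(1 + s)) := by
          gcongr
          exact (abs_sin_le_abs).trans_eq (abs_of_pos hx0)
      _ = x ^ (-s) := by
          rw [show -s = 1 + -(1 + s) by ring, rpow_add hx0, rpow_one]
  · have h : IntegrableOn (fun x : ℝ => x ^ (-(1 + s))) (Ioi 1) :=
      integrableOn_Ioi_rpow_of_lt (by linarith) one_pos
    refine h.mono' (Measurable.aestronglyMeasurable (by fun_prop)) ?_
    filter_upwards [self_mem_ae_restrict measurableSet_Ioi] with x (hx : 1 < x)
    have hx0 : 0 < x := one_pos.trans hx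
    rw [norm_mul, norm_eq_abs, norm_eq_abs, abs_of_pos (rpow_pos_of_pos hx0 _)]
    exact mul_le_of_le_one_left (by positivity) (abs_sin_le_one x)

/-- Replace `x^(-(1+s)) Γ(1+s)` by the Laplace integral of `t^s` and swap. Absolute convergence of
the double integral reduces to `integrableOn_sin_mul_rpow`. The value is the radial factor in the
normalization of `Comega`. -/
theorem integral_sin_mul_rpow {s : ℝ} (hs0 : 0 < s) (hs1 : s < 1) :
    ∫ x in Ioi (0 : ℝ), sin x * x ^ (-(1 + s)) = Gamma (1 - s) / s * sin (π * s / 2) := by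
  have hG : 0 < Gamma (1 + s) := Gamma_pos_of_pos (by linarith)
  have inner_t : ∀ x ∈ Ioi (0 : ℝ), ∫ t in Ioi (0 : ℝ), t ^ s * rexp (-(x * t)) =
      x ^ (-(1 + s)) * Gamma (1 + s) := by
    intro x (hx : 0 < x)
    have := integral_rpow_mul_exp_neg_mul_Ioi (a := 1 + s) (by linarith) hx
    rwa [add_sub_cancel_left, one_div, inv_rpow hx.le, ← rpow_neg hx.le] at this
  have hprod : Integrable (Function.uncurry fun x t : ℝ => sin x * (t ^ s * rexp (-(x * t))))
      ((volume.restrict (Ioi 0)).prod (volume.restrict (Ioi 0))) := by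
    refine (integrable_prod_iff (Measurable.aestronglyMeasurable (by
      simp only [Function.uncurry_def]; fun_prop))).2 ⟨?_, ?_⟩
    · filter_upwards [self_mem_ae_restrict measurableSet_Ioi] with x (hx : 0 < x)
      suffices hi : IntegrableOn (fun t => t ^ s * rexp (-(x * t))) (Ioi 0) from
        Integrable.const_mul hi (sin x)
      by_contra hn
      have h1 := inner_t x hx
      rw [integral_undef hn] at h1
      have := rpow_pos_of_pos hx (-(1 + s))
      exact (mul_pos this hG).ne h1
    · refine (((integrableOn_sin_mul_rpow hs0 hs1).norm).mul_const (Gamma (1 + s))).congr ?_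
      filter_upwards [self_mem_ae_restrict measurableSet_Ioi] with x (hx : 0 < x)
      simp only [Function.uncurry_apply_pair, norm_mul]
      rw [integral_const_mul, mul_assoc]
      congr 1
      rw [Real.norm_of_nonneg (rpow_nonneg hx.le _), ← inner_t x hx]
      refine setIntegral_congr_fun measurableSet_Ioi fun t (ht : 0 < t) => ?_
      simp only [Real.norm_of_nonneg (rpow_nonneg ht.le s), Real.norm_of_nonneg (exp_pos _).le]
  have hswap := integral_integral_swap hprod
  have hl : ∫ x in Ioi (0 : ℝ), ∫ t in Ioi (0 : ℝ), sin x * (t ^ s * rexp (-(x * t))) =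
      (∫ x in Ioi (0 : ℝ), sin x * x ^ (-(1 + s))) * Gamma (1 + s) := by
    rw [← integral_mul_const]
    refine setIntegral_congr_fun measurableSet_Ioi fun x hx => ?_
    simp only [integral_const_mul, inner_t x hx, mul_assoc]
  have hr : ∫ t in Ioi (0 : ℝ), ∫ x in Ioi (0 : ℝ), sin x * (t ^ s * rexp (-(x * t))) =
      π / (2 * cos (π * s / 2)) := by
    rw [← integral_rpow_div_one_add_sq hs0 hs1]
    refine setIntegral_congr_fun measurableSet_Ioi fun t (ht : 0 < t) => ?_
    rw [show (fun x => sin x * (t ^ s * rexp (-(x * t)))) =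
      fun x => t ^ s * (sin x * rexp (-(t * x))) by ext x; rw [mul_comm x t]; ring,
      integral_const_mul, integral_sin_mul_exp_neg_mul ht, mul_one_div]
  rw [hl, hr] at hswap
  have hsin : 0 < sin (π * s / 2) := by
    apply sin_pos_of_pos_of_lt_pi <;> nlinarith [pi_pos]
  have hcos : 0 < cos (π * s / 2) := by
    apply cos_pos_of_mem_Ioo
    constructor <;> nlinarith [pi_pos]
  have hrefl := Gamma_mul_Gamma_one_sub s
  rw [show π * s = 2 * (π * s / 2) by ring, sin_two_mul] at hrefl
  have hG2 : Gamma (1 + s) = s * Gamma s := by rw [add_comm, Gamma_add_one hs0.ne']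
  have hGs : 0 < Gamma s := Gamma_pos_of_pos hs0
  have e2 : Gamma (1 - s) = π / (2 * sin (π * s / 2) * cos (π * s / 2)) / Gamma s := by
    rw [← hrefl]; field_simp
  rw [eq_div_of_mul_eq hG.ne' hswap, e2, hG2]
  field_simp

end

/-! ### The symbol of the fractional Laplacian and the constant `Cns`. -/

section

open Set Real

theorem Gamma_neg_abs {s : ℝ} (hs0 : 0 < s) (hs1 : s < 1) : |Gamma (-s)| = Gamma (1 - s) / s := by
  have h := Gamma_add_one (s := -s) (by linarith)
  rw [neg_add_eq_sub] at h
  have hG : 0 < Gamma (1 - s) := Gamma_pos_of_pos (by linarith)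
  rw [h, abs_of_neg (by nlinarith)]
  field_simp

theorem Cns_pos (n : ℕ) {s : ℝ} (hs0 : 0 < s) (hs1 : s < 1) : 0 < Cns n s := by
  unfold Cns
  rw [Gamma_neg_abs hs0 hs1]
  have hG : 0 < Gamma (1 - s) := Gamma_pos_of_pos (by linarith)
  have hG : 0 < Gamma (s + n / 2) := Gamma_pos_of_pos (by positivity)
  positivity

/-- The cosine term is the real part of the Fourier integral of a Gaussian. -/
theorem integrable_two_sub_two_cos_mul_gaussian {n : ℕ} (ξ : E n) {t : ℝ} (ht : 0 < t) :
    Integrable (fun z : E n => (2 - 2 * cos (2 * π * inner ℝ ξ z)) * rexp (-(t * ‖z‖ ^ 2))) ∧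
    ∫ z : E n, (2 - 2 * cos (2 * π * inner ℝ ξ z)) * rexp (-(t * ‖z‖ ^ 2)) =
      2 * (π / t) ^ ((n : ℝ) / 2) * (1 - rexp (-(π ^ 2 * ‖ξ‖ ^ 2 / t))) := by
  have hre : ∀ z : E n, (Complex.exp (-(t : ℂ) * ‖z‖ ^ 2 +
      (2 * π * Complex.I) * (inner ℝ ξ z : ℝ))).re =
      cos (2 * π * inner ℝ ξ z) * rexp (-(t * ‖z‖ ^ 2)) := by
    intro z
    rw [show -(t : ℂ) * ‖z‖ ^ 2 + (2 * π * Complex.I) * (inner ℝ ξ z : ℝ) =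
      ((-(t * ‖z‖ ^ 2) : ℝ) : ℂ) + ((2 * π * inner ℝ ξ z : ℝ) : ℂ) * Complex.I by
        push_cast; ring, Complex.exp_re]
    simp only [Complex.add_re, Complex.add_im, Complex.ofReal_re, Complex.ofReal_im,
      Complex.re_ofReal_mul, Complex.im_ofReal_mul, Complex.I_re, Complex.I_im, mul_zero, mul_one,
      add_zero, zero_add]
    rw [mul_comm]
  have hi1 := GaussianFourier.integrable_cexp_neg_mul_sq_norm_add (b := (t : ℂ))
    (by simpa using ht) (2 * π * Complex.I) ξ
  have hv1 := GaussianFourier.integral_cexp_neg_mul_sq_norm_add (b := (t : ℂ))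
    (by simpa using ht) (2 * π * Complex.I) ξ
  have hic : Integrable (fun z : E n => cos (2 * π * inner ℝ ξ z) * rexp (-(t * ‖z‖ ^ 2))) := by
    simpa only [RCLike.re_to_complex, hre] using hi1.re
  have hvc : ∫ z : E n, cos (2 * π * inner ℝ ξ z) * rexp (-(t * ‖z‖ ^ 2)) =
      (π / t) ^ ((n : ℝ) / 2) * rexp (-(π ^ 2 * ‖ξ‖ ^ 2 / t)) := by
    have h := integral_re hi1
    simp only [RCLike.re_to_complex] at h
    rw [hv1] at h
    simp only [hre] at h
    rw [h]
    have e1 : (2 * π * Complex.I) ^ 2 * (‖ξ‖ : ℂ) ^ 2 / (4 * t) =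
        ((-(π ^ 2 * ‖ξ‖ ^ 2 / t) : ℝ) : ℂ) := by
      rw [mul_pow, Complex.I_sq]
      push_cast
      field_simp
      norm_num
      ring
    have e2 : ((π : ℂ) / t) ^ ((Module.finrank ℝ (E n) : ℂ) / 2) =
        (((π / t) ^ ((n : ℝ) / 2) : ℝ) : ℂ) := by
      rw [Complex.ofReal_cpow (by positivity)]
      simp
    rw [e1, e2, ← Complex.ofReal_exp, ← Complex.ofReal_mul, Complex.ofReal_re]
  have hi0 : Integrable (fun z : E n => rexp (-(t * ‖z‖ ^ 2))) := by
    by_contra hn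
    have h := GaussianFourier.integral_rexp_neg_mul_sq_norm (V := E n) ht
    simp only [neg_mul] at h
    rw [integral_undef hn] at h
    have : 0 < (π / t) ^ ((Module.finrank ℝ (E n) : ℝ) / 2) := by positivity
    exact this.ne h
  have hv0 := GaussianFourier.integral_rexp_neg_mul_sq_norm (V := E n) ht
  simp only [neg_mul, finrank_euclideanSpace, Fintype.card_fin] at hv0
  have heq : (fun z : E n => (2 - 2 * cos (2 * π * inner ℝ ξ z)) * rexp (-(t * ‖z‖ ^ 2))) =
      fun z => 2 * rexp (-(t * ‖z‖ ^ 2)) -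
        2 * (cos (2 * π * inner ℝ ξ z) * rexp (-(t * ‖z‖ ^ 2))) := by
    ext z; ring
  rw [heq]
  refine ⟨(hi0.const_mul 2).sub (hic.const_mul 2), ?_⟩
  rw [integral_sub (hi0.const_mul 2) (hic.const_mul 2), integral_const_mul, integral_const_mul,
    hv0, hvc]
  ring

/-- The symbol of the fractional Laplacian. -/
theorem lintegral_two_sub_two_cos_div {n : ℕ} [NeZero n] {s : ℝ} (hs0 : 0 < s) (hs1 : s < 1)
    (ξ : E n) :
    ∫⁻ z : E n, ENNReal.ofReal
      ((2 - 2 * cos (2 * π * inner ℝ ξ z)) / ‖z‖ ^ ((n : ℝ) + 2 * s)) =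
      ENNReal.ofReal (2 / Cns n s * (2 * π * ‖ξ‖) ^ (2 * s)) := by
  set p : ℝ := s + n / 2 with hp
  have hp0 : 0 < p := by positivity
  have hG : 0 < Gamma p := Gamma_pos_of_pos hp0
  have hG1 : 0 < Gamma (1 - s) := Gamma_pos_of_pos (by linarith)
  have hD : ∀ z : E n, 0 ≤ 2 - 2 * cos (2 * π * inner ℝ ξ z) := fun z => by
    have := cos_le_one (2 * π * inner ℝ ξ z)
    linarith
  -- Subordination: `Γ(p) ‖z‖^(-2p)` is the integral of `t^(p-1) exp(-t‖z‖²)` over `t > 0`. As `2p =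
  -- n + 2s`, Tonelli replaces the singular weight by Gaussians, and a one-dimensional integral in
  -- `t` remains.
  have hmul : (∫⁻ z : E n, ENNReal.ofReal
      ((2 - 2 * cos (2 * π * inner ℝ ξ z)) / ‖z‖ ^ ((n : ℝ) + 2 * s))) * ENNReal.ofReal (Gamma p) =
      ENNReal.ofReal (2 * π ^ ((n : ℝ) / 2) * ((π ^ 2 * ‖ξ‖ ^ 2) ^ s * (Gamma (1 - s) / s))) := by
    rw [← lintegral_mul_const' _ _ ENNReal.ofReal_ne_top]
    calc _ = ∫⁻ z : E n, ∫⁻ t in Ioi (0 : ℝ), ENNReal.ofReal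
          ((2 - 2 * cos (2 * π * inner ℝ ξ z)) * (t ^ (p - 1) * rexp (-(‖z‖ ^ 2 * t)))) := by
          refine lintegral_congr_ae ?_
          filter_upwards [compl_mem_ae_iff.2 (measure_singleton (μ := volume) (0 : E n))] with z hz
          have hz : 0 < ‖z‖ := norm_pos_iff.2 (by simpa using hz)
          simp_rw [ENNReal.ofReal_mul (hD z)]
          rw [lintegral_const_mul' _ _ ENNReal.ofReal_ne_top,
            lintegral_rpow_mul_exp_neg_mul hp0 (by positivity),
            ← ENNReal.ofReal_mul (hD z), ← ENNReal.ofReal_mul (div_nonneg (hD z) (by positivity))]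
          congr 1
          rw [rpow_neg (by positivity), ← rpow_natCast, ← rpow_mul hz.le,
            show ((2 : ℕ) : ℝ) * p = n + 2 * s by rw [hp]; push_cast; ring]
          ring
      _ = ∫⁻ t in Ioi (0 : ℝ), ∫⁻ z : E n, ENNReal.ofReal
          ((2 - 2 * cos (2 * π * inner ℝ ξ z)) * (t ^ (p - 1) * rexp (-(‖z‖ ^ 2 * t)))) := by
          refine lintegral_lintegral_swap (Measurable.aemeasurable ?_)
          simp only [Function.uncurry_def]
          fun_prop
      _ = ∫⁻ t in Ioi (0 : ℝ), ENNReal.ofReal (2 * π ^ ((n : ℝ) / 2)) *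
            ENNReal.ofReal (t ^ (s - 1) * (1 - rexp (-(π ^ 2 * ‖ξ‖ ^ 2 / t)))) := by
          refine setLIntegral_congr_fun measurableSet_Ioi fun t (ht : 0 < t) => ?_
          obtain ⟨hi, hv⟩ := integrable_two_sub_two_cos_mul_gaussian ξ ht
          have e : ∀ z : E n, (2 - 2 * cos (2 * π * inner ℝ ξ z)) *
              (t ^ (p - 1) * rexp (-(‖z‖ ^ 2 * t))) = t ^ (p - 1) *
              ((2 - 2 * cos (2 * π * inner ℝ ξ z)) * rexp (-(t * ‖z‖ ^ 2))) := fun z => by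
            rw [mul_comm (‖z‖ ^ 2) t]; ring
          simp only [e]
          rw [← ofReal_integral_eq_lintegral_ofReal (hi.const_mul _) (ae_of_all _ fun z =>
            mul_nonneg (by positivity) (mul_nonneg (hD z) (exp_pos _).le)), integral_const_mul, hv,
            ← ENNReal.ofReal_mul (by positivity)]
          congr 1
          rw [div_rpow pi_pos.le ht.le, show p - 1 = (s - 1) + n / 2 by rw [hp]; ring,
            rpow_add ht]
          field_simp
      _ = _ := by
          rw [lintegral_const_mul' _ _ ENNReal.ofReal_ne_top,
            lintegral_rpow_mul_one_sub_exp_neg_div hs0 hs1 (by positivity),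
            ← ENNReal.ofReal_mul (by positivity)]
  have h2 := (ENNReal.eq_div_iff (by simpa using hG) ENNReal.ofReal_ne_top).2
    ((mul_comm (ENNReal.ofReal (Gamma p)) _).trans hmul)
  rw [h2, ← ENNReal.ofReal_div_of_pos hG]
  congr 1
  unfold Cns
  rw [Gamma_neg_abs hs0 hs1, ← hp, ← mul_pow, show (2 * π * ‖ξ‖) = 2 * (π * ‖ξ‖) by ring,
    mul_rpow (by norm_num) (by positivity), rpow_mul (by norm_num) 2 s, rpow_mul (by positivity),
    rpow_ofNat, rpow_ofNat]
  have h4 : (4 : ℝ) ^ s ≠ 0 := by positivity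
  norm_num
  field_simp

end

/-! ### The gradient kernel, its full and truncated symbols, and polar coordinates. -/

section

open Set Real

/-- The kernel of the fractional gradient: `fracWeight x y • fracKernel x y` as a function of
`z = y - x`. -/
def gradKernel (n : ℕ) [NeZero n] (s : ℝ) (z : E n) : E n :=
  (Comega n s * ‖z‖ ^ (-((n : ℝ) + s))) • (‖z‖⁻¹ • z)

variable {n : ℕ} [NeZero n] {s : ℝ}

theorem fracWeight_smul_fracKernel (c : ℝ) (x y : E n) :
    (fracWeight n s x y * c) • fracKernel n x y = c • gradKernel n s (y - x) := by
  rw [fracWeight, fracKernel, gradKernel, norm_sub_rev x y, mul_comm _ c, mul_smul]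

theorem measurable_gradKernel : Measurable (gradKernel n s) := by
  unfold gradKernel
  fun_prop

theorem gradKernel_neg (z : E n) : gradKernel n s (-z) = -gradKernel n s z := by
  simp [gradKernel]

theorem norm_gradKernel_le (z : E n) :
    ‖gradKernel n s z‖ ≤ |Comega n s| * ‖z‖ ^ (-((n : ℝ) + s)) := by
  rw [gradKernel, norm_smul, norm_mul, norm_smul, norm_inv, norm_norm, norm_eq_abs, norm_eq_abs,
    abs_of_nonneg (rpow_nonneg (norm_nonneg z) _)]
  refine mul_le_of_le_one_right (by positivity) ?_
  exact inv_mul_le_one_of_le₀ le_rfl (norm_nonneg z)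

/-- In polar coordinates the integrand is `r^(-s)` on `(0,1]` and `r^(-(1+s))` beyond. It is the
common majorant: the sine contributes `min 1 (2π‖ξ‖‖z‖)`, and this cancels one power of the
singularity. -/
theorem integrable_min_mul_rpow_norm (hs0 : 0 < s) (hs1 : s < 1) :
    Integrable (fun z : E n => min 1 ‖z‖ * ‖z‖ ^ (-((n : ℝ) + s))) := by
  have hn : 0 < n := NeZero.pos n
  have : Nontrivial (E n) := by
    have : Nonempty (Fin n) := ⟨0⟩
    infer_instance
  refine (integrable_fun_norm_addHaar (E := E n) volume
    (f := fun r => min 1 r * r ^ (-((n : ℝ) + s)))).2 ?_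
  rw [finrank_euclideanSpace, Fintype.card_fin]
  have hpow : ∀ y : ℝ, 0 < y → y ^ (n - 1) * y ^ (-((n : ℝ) + s)) = y ^ (-(1 + s)) := by
    intro y hy
    rw [← rpow_natCast, ← rpow_add hy, Nat.cast_pred hn]
    congr 1; ring
  rw [← Ioc_union_Ioi_eq_Ioi zero_le_one]
  refine IntegrableOn.union ?_ ?_
  · have h : IntegrableOn (fun x : ℝ => x ^ (-s)) (Ioc 0 1) :=
      (intervalIntegral.intervalIntegrable_rpow' (by linarith : -1 < -s) (a := 0) (b := 1)).1
    refine h.congr_fun (fun y hy => ?_) measurableSet_Ioc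
    simp only [smul_eq_mul]
    rw [min_eq_right hy.2, mul_left_comm, hpow y hy.1, show -s = 1 + -(1 + s) by ring,
      rpow_add hy.1, rpow_one]
  · have h : IntegrableOn (fun x : ℝ => x ^ (-(1 + s))) (Ioi 1) :=
      integrableOn_Ioi_rpow_of_lt (by linarith) one_pos
    refine h.congr_fun (fun y (hy : 1 < y) => ?_) measurableSet_Ioi
    simp only [smul_eq_mul]
    rw [min_eq_left hy.le, one_mul, hpow y (one_pos.trans hy)]

theorem min_mul_rpow_norm_smul {n : ℕ} {s ρ : ℝ} (hρ : 0 < ρ) (z : E n) :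
    min 1 ‖ρ • z‖ * ‖ρ • z‖ ^ (-((n : ℝ) + s)) =
      ρ ^ (-((n : ℝ) + s)) * (min 1 (ρ * ‖z‖) * ‖z‖ ^ (-((n : ℝ) + s))) := by
  rw [norm_smul, Real.norm_of_nonneg hρ.le, mul_rpow hρ.le (norm_nonneg _)]
  ring

theorem integrable_min_mul_rpow_norm_scaled (hs0 : 0 < s) (hs1 : s < 1) {ρ : ℝ} (hρ : 0 < ρ) :
    Integrable (fun z : E n => min 1 (ρ * ‖z‖) * ‖z‖ ^ (-((n : ℝ) + s))) := by
  have h := ((integrable_min_mul_rpow_norm (n := n) hs0 hs1).comp_smul hρ.ne').const_mul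
    (ρ ^ ((n : ℝ) + s))
  refine h.congr (ae_of_all _ fun z => ?_)
  simp only [min_mul_rpow_norm_smul hρ]
  rw [← mul_assoc, ← rpow_add hρ, add_neg_cancel, rpow_zero, one_mul]

theorem rpow_mul_abs_inv_pow {n : ℕ} {s ρ : ℝ} (hρ : 0 < ρ) :
    ρ ^ ((n : ℝ) + s) * |(ρ ^ Module.finrank ℝ (E n))⁻¹| = ρ ^ s := by
  rw [finrank_euclideanSpace, Fintype.card_fin, abs_of_pos (by positivity), rpow_add hρ,
    rpow_natCast]
  field_simp

/-- Homogeneity of degree `-(n+s)` against the Jacobian `ρ^n` leaves `ρ^s`. With `ρ = 2π‖ξ‖` this is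
the growth of the symbols. -/
theorem integral_min_mul_rpow_norm_scaled {n : ℕ} {s ρ : ℝ} (hρ : 0 < ρ) :
    ∫ z : E n, min 1 (ρ * ‖z‖) * ‖z‖ ^ (-((n : ℝ) + s)) =
      ρ ^ s * ∫ z : E n, min 1 ‖z‖ * ‖z‖ ^ (-((n : ℝ) + s)) := by
  have h := Measure.integral_comp_smul (volume : Measure (E n))
    (fun z => min 1 ‖z‖ * ‖z‖ ^ (-((n : ℝ) + s))) ρ
  simp only [min_mul_rpow_norm_smul hρ, integral_const_mul, smul_eq_mul] at h
  rw [← rpow_mul_abs_inv_pow (n := n) hρ, mul_assoc, ← h, ← mul_assoc, ← rpow_add hρ, add_neg_cancel,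
    rpow_zero, one_mul]

theorem norm_sin_smul_gradKernel_le (ξ z : E n) :
    ‖sin (2 * π * inner ℝ ξ z) • gradKernel n s z‖ ≤
      |Comega n s| * (min 1 ((2 * π * ‖ξ‖) * ‖z‖) * ‖z‖ ^ (-((n : ℝ) + s))) := by
  rw [norm_smul, norm_eq_abs, mul_left_comm]
  refine mul_le_mul (le_min (abs_sin_le_one _) ?_) (norm_gradKernel_le z) (norm_nonneg _)
    (by positivity)
  refine abs_sin_le_abs.trans ?_
  rw [abs_mul, abs_of_pos two_pi_pos, mul_assoc (2 * π)]
  have := abs_real_inner_le_norm ξ z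
  gcongr

theorem integrable_sin_smul_gradKernel (hs0 : 0 < s) (hs1 : s < 1) (ξ : E n) :
    Integrable (fun z : E n => sin (2 * π * inner ℝ ξ z) • gradKernel n s z) := by
  rcases eq_or_ne ξ 0 with rfl | hξ
  · simp
  · have hρ : 0 < 2 * π * ‖ξ‖ := by positivity
    refine ((integrable_min_mul_rpow_norm_scaled (n := n) hs0 hs1 hρ).const_mul
      |Comega n s|).mono' ?_ (ae_of_all _ (norm_sin_smul_gradKernel_le ξ))
    have := measurable_gradKernel (n := n) (s := s)
    exact Measurable.aestronglyMeasurable (by fun_prop)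

/-- The symbol of the fractional gradient. -/
def gradSymbol (n : ℕ) [NeZero n] (s : ℝ) (ξ : E n) : E n :=
  ∫ z, sin (2 * π * inner ℝ ξ z) • gradKernel n s z

/-- The symbol of the fractional gradient truncated to `ε < ‖z‖`. -/
def truncSymbol (n : ℕ) [NeZero n] (s ε : ℝ) (ξ : E n) : E n :=
  ∫ z in {z | ε < ‖z‖}, sin (2 * π * inner ℝ ξ z) • gradKernel n s z

/-- The constant in the uniform bound of the truncated symbols. -/
def symbolBound (n : ℕ) [NeZero n] (s : ℝ) : ℝ :=
  |Comega n s| * ∫ z : E n, min 1 ‖z‖ * ‖z‖ ^ (-((n : ℝ) + s))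

theorem integral_norm_sin_smul_gradKernel_le (hs0 : 0 < s) (hs1 : s < 1) (ξ : E n) :
    ∫ z, ‖sin (2 * π * inner ℝ ξ z) • gradKernel n s z‖ ≤
      symbolBound n s * (2 * π * ‖ξ‖) ^ s := by
  rcases eq_or_ne ξ 0 with rfl | hξ
  · simp [zero_rpow hs0.ne']
  · have hρ : 0 < 2 * π * ‖ξ‖ := by positivity
    calc _ ≤ ∫ z : E n, |Comega n s| * (min 1 ((2 * π * ‖ξ‖) * ‖z‖) * ‖z‖ ^ (-((n : ℝ) + s))) :=
          integral_mono (integrable_sin_smul_gradKernel hs0 hs1 ξ).norm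
            ((integrable_min_mul_rpow_norm_scaled hs0 hs1 hρ).const_mul _)
            (norm_sin_smul_gradKernel_le ξ)
      _ = _ := by
          rw [integral_const_mul, integral_min_mul_rpow_norm_scaled hρ, symbolBound]
          ring

/-- Absolute convergence makes the bound independent of `ε`; it supplies the majorant for the limit
`ε ↓ 0` on the Fourier side. -/
theorem norm_truncSymbol_le (hs0 : 0 < s) (hs1 : s < 1) (ε : ℝ) (ξ : E n) :
    ‖truncSymbol n s ε ξ‖ ≤ symbolBound n s * (2 * π * ‖ξ‖) ^ s := by
  refine (norm_integral_le_integral_norm _).trans ?_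
  refine le_trans ?_ (integral_norm_sin_smul_gradKernel_le hs0 hs1 ξ)
  exact setIntegral_le_integral (integrable_sin_smul_gradKernel hs0 hs1 ξ).norm
    (ae_of_all _ fun z => norm_nonneg _)

theorem measurableSet_lt_norm {n : ℕ} (ε : ℝ) : MeasurableSet {z : E n | ε < ‖z‖} :=
  measurableSet_lt measurable_const measurable_norm

theorem tendsto_truncSymbol (hs0 : 0 < s) (hs1 : s < 1) (ξ : E n) :
    Tendsto (fun ε => truncSymbol n s ε ξ) (𝓝[>] 0) (𝓝 (gradSymbol n s ξ)) := by
  have hint := integrable_sin_smul_gradKernel hs0 hs1 ξ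
  simp only [truncSymbol, gradSymbol, ← integral_indicator (measurableSet_lt_norm _)]
  refine tendsto_integral_filter_of_dominated_convergence
    (fun z => ‖sin (2 * π * inner ℝ ξ z) • gradKernel n s z‖) ?_ ?_ hint.norm ?_
  · exact Eventually.of_forall fun ε =>
      hint.aestronglyMeasurable.indicator (measurableSet_lt_norm ε)
  · exact Eventually.of_forall fun ε => ae_of_all _ fun z => norm_indicator_le_norm_self _ _
  · filter_upwards [compl_mem_ae_iff.2 (measure_singleton (μ := volume) (0 : E n))] with z hz
    have hz : 0 < ‖z‖ := norm_pos_iff.2 (by simpa using hz)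
    refine tendsto_const_nhds.congr' ?_
    filter_upwards [nhdsWithin_le_nhds (Iio_mem_nhds hz)] with ε (hε : ε < ‖z‖)
    rw [indicator_of_mem (show z ∈ {z : E n | ε < ‖z‖} from hε)]

/-- Integration in polar coordinates. -/
theorem integral_eq_integral_sphere_Ioi {f : E n → ℝ} (hf : Integrable f) :
    ∫ x, f x = ∫ θ : Metric.sphere (0 : E n) 1, ∫ r in Ioi (0 : ℝ), r ^ (n - 1) * f (r • (θ : E n))
      ∂volume ∂((volume : Measure (E n)).toSphere) := by
  -- Off the origin, which is null, volume is the product of `toSphere` and `r^(n-1) dr`.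
  have hmp := (volume : Measure (E n)).measurePreserving_homeomorphUnitSphereProd
  rw [finrank_euclideanSpace, Fintype.card_fin] at hmp
  have hemb := (homeomorphUnitSphereProd (E n)).measurableEmbedding
  set g : Metric.sphere (0 : E n) 1 × Ioi (0 : ℝ) → ℝ := fun p => f ((p.2 : ℝ) • (p.1 : E n))
    with hg
  have hcomp : ∀ x : ({0}ᶜ : Set (E n)), g (homeomorphUnitSphereProd (E n) x) = f x := by
    intro x
    have hx : (x : E n) ≠ 0 := x.2
    simp [hg, smul_smul, hx]
  have hgi : Integrable g ((volume : Measure (E n)).toSphere.prod (Measure.volumeIoiPow (n - 1))) := by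
    rw [← hmp.integrable_comp_emb hemb]
    have : g ∘ (homeomorphUnitSphereProd (E n)) = f ∘ Subtype.val := funext hcomp
    rw [this, ← integrableOn_iff_comap_subtypeVal (measurableSet_singleton _).compl]
    exact hf.integrableOn
  calc ∫ x, f x = ∫ x : ({0}ᶜ : Set (E n)), f x ∂(volume.comap Subtype.val) := by
        rw [integral_subtype_comap (measurableSet_singleton _).compl f, restrict_compl_singleton]
    _ = ∫ p, g p ∂((volume : Measure (E n)).toSphere.prod (Measure.volumeIoiPow (n - 1))) := by
        rw [← hmp.integral_comp hemb]
        simp only [hcomp]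
    _ = ∫ θ : Metric.sphere (0 : E n) 1, ∫ r : Ioi (0 : ℝ), f ((r : ℝ) • (θ : E n))
          ∂(Measure.volumeIoiPow (n - 1)) ∂((volume : Measure (E n)).toSphere) :=
        integral_prod _ hgi
    _ = _ := by
        refine integral_congr_ae (ae_of_all _ fun θ => ?_)
        simp only [Measure.volumeIoiPow, ENNReal.ofReal]
        rw [integral_withDensity_eq_integral_smul
          ((measurable_subtype_coe.pow_const _).real_toNNReal),
          integral_subtype_comap measurableSet_Ioi
            fun a : ℝ => Real.toNNReal (a ^ (n - 1)) • f (a • (θ : E n))]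
        refine setIntegral_congr_fun measurableSet_Ioi fun x (hx : 0 < x) => ?_
        simp only [NNReal.smul_def, Real.coe_toNNReal _ (pow_nonneg hx.le _), smul_eq_mul]

/-- Since `b sin(rb)` is even in `b`, one may pass to `|b|` and substitute `x = |b| r`. -/
theorem integral_mul_sin_mul_rpow (hs0 : 0 < s) (hs1 : s < 1) (b : ℝ) :
    ∫ r in Ioi (0 : ℝ), b * sin (r * b) * r ^ (-(1 + s)) =
      Gamma (1 - s) / s * sin (π * s / 2) * |b| ^ (s + 1) := by
  rcases eq_or_ne b 0 with rfl | hb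
  · simp [zero_rpow (show s + 1 ≠ 0 by linarith)]
  · have hb' : 0 < |b| := abs_pos.2 hb
    have e : ∀ r ∈ Ioi (0 : ℝ), b * sin (r * b) * r ^ (-(1 + s)) =
        |b| ^ (s + 2) * (sin (|b| * r) * (|b| * r) ^ (-(1 + s))) := by
      intro r (hr : 0 < r)
      rw [mul_rpow hb'.le hr.le, show s + 2 = 1 + (1 + s) by ring, rpow_add hb', rpow_neg hb'.le,
        rpow_one]
      have : |b| ^ (1 + s) ≠ 0 := by positivity
      have h2 : b * sin (r * b) = |b| * sin (|b| * r) := by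
        rcases abs_cases b with ⟨h, _⟩ | ⟨h, _⟩ <;> rw [h]
        · rw [mul_comm r]
        · rw [neg_mul, neg_mul, sin_neg, mul_neg, neg_neg, mul_comm r]
      rw [h2]
      field_simp
    rw [setIntegral_congr_fun measurableSet_Ioi e, integral_const_mul,
      integral_comp_mul_left_Ioi (fun x => sin x * x ^ (-(1 + s))) 0 hb', mul_zero,
      integral_sin_mul_rpow hs0 hs1, show s + 2 = s + 1 + 1 by ring, rpow_add_one hb'.ne']
    simp only [smul_eq_mul]
    field_simp

/-- The moment of the hemisphere that enters the normalizing constant `Comega`. -/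
def sphereMoment (n : ℕ) [NeZero n] (s : ℝ) : ℝ :=
  ∫ θ in {θ : Metric.sphere (0 : E n) 1 | 0 ≤ (θ : E n) 0},
    |(θ : E n) 0| ^ (s + 1) ∂((volume : Measure (E n)).toSphere)

/-- The integrand is positive on the open hemisphere, a nonempty open set of the sphere. Hence the
denominator of `Comega` does not vanish. -/
theorem sphereMoment_pos (hs0 : 0 < s) : 0 < sphereMoment n s := by
  have hc0 : Continuous fun θ : Metric.sphere (0 : E n) 1 => (θ : E n) 0 := by fun_prop
  have hcont : Continuous fun θ : Metric.sphere (0 : E n) 1 => |(θ : E n) 0| ^ (s + 1) :=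
    hc0.abs.rpow_const fun _ => Or.inr (by linarith)
  have hint : Integrable (fun θ : Metric.sphere (0 : E n) 1 => |(θ : E n) 0| ^ (s + 1))
      (volume : Measure (E n)).toSphere := by
    have := hcont.continuousOn.integrableOn_compact (μ := (volume : Measure (E n)).toSphere)
      isCompact_univ
    simpa using this
  refine (setIntegral_pos_iff_support_of_nonneg_ae (ae_of_all _ fun θ => by
    simp only [Pi.zero_apply]; positivity) hint.integrableOn).2 ?_
  have hopen : IsOpen {θ : Metric.sphere (0 : E n) 1 | 0 < (θ : E n) 0} :=
    isOpen_lt continuous_const hc0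
  have hne : {θ : Metric.sphere (0 : E n) 1 | 0 < (θ : E n) 0}.Nonempty :=
    ⟨⟨EuclideanSpace.single 0 1, by simp⟩, by simp⟩
  refine (hopen.measure_pos _ hne).trans_le (measure_mono fun θ hθ => ⟨?_, ?_⟩)
  · have hθ : 0 < (θ : E n) 0 := hθ
    exact (rpow_pos_of_pos (abs_pos.2 hθ.ne') _).ne'
  · exact le_of_lt (show 0 < (θ : E n) 0 from hθ)

end

/-! ### The modulus of the gradient symbol. -/

section

open Set Real

variable {n : ℕ} [NeZero n] {s : ℝ}

/-- The gradient symbol at a normalized frequency. -/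
def gradSymbolUnit (n : ℕ) [NeZero n] (s : ℝ) : E n :=
  ∫ w : E n, sin (w 0) • gradKernel n s w

theorem gradKernel_isometry (R : E n ≃ₗᵢ[ℝ] E n) (z : E n) :
    gradKernel n s (R z) = R (gradKernel n s z) := by
  simp [gradKernel]

theorem gradKernel_smul {ρ : ℝ} (hρ : 0 < ρ) (z : E n) :
    gradKernel n s (ρ • z) = ρ ^ (-((n : ℝ) + s)) • gradKernel n s z := by
  rw [gradKernel, gradKernel, norm_smul, Real.norm_of_nonneg hρ.le,
    mul_rpow hρ.le (norm_nonneg _), smul_smul, smul_smul, smul_smul, smul_smul]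
  congr 1
  field_simp

theorem integrable_sin_coord_smul_gradKernel (hs0 : 0 < s) (hs1 : s < 1) :
    Integrable (fun w : E n => sin (w 0) • gradKernel n s w) := by
  have h := integrable_sin_smul_gradKernel (n := n) hs0 hs1
    ((2 * π)⁻¹ • EuclideanSpace.single (0 : Fin n) (1 : ℝ))
  refine h.congr (ae_of_all _ fun w => ?_)
  simp only [inner_smul_left, EuclideanSpace.inner_single_left, map_one, one_mul]
  congr 2
  simp
  field_simp

theorem integral_sin_scaled {ρ : ℝ} (hρ : 0 < ρ) :
    ∫ w : E n, sin (ρ * w 0) • gradKernel n s w = ρ ^ s • gradSymbolUnit n s := by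
  have h := Measure.integral_comp_smul (volume : Measure (E n))
    (fun w => sin (w 0) • gradKernel n s w) ρ
  rw [← rpow_mul_abs_inv_pow (n := n) hρ, mul_smul, gradSymbolUnit, ← h, ← integral_smul]
  refine integral_congr_ae (ae_of_all _ fun w => ?_)
  simp only [gradKernel_smul hρ, PiLp.smul_apply, smul_eq_mul, smul_smul]
  congr 1
  rw [mul_comm (sin _), ← mul_assoc, ← rpow_add hρ, add_neg_cancel, rpow_zero, one_mul]

/-- The reflection in the hyperplane orthogonal to the difference of two unit vectors exchanges
them. -/
theorem exists_isometry_single {v : E n} (hv : ‖v‖ = 1) :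
    ∃ R : E n ≃ₗᵢ[ℝ] E n, R (EuclideanSpace.single 0 1) = v :=
  ⟨_, Submodule.reflection_sub (v := EuclideanSpace.single (0 : Fin n) (1 : ℝ)) (w := v)
    (by simp [hv])⟩

/-- The kernel commutes with isometries and is homogeneous, so rotating `ξ` onto the first axis and
rescaling reduces every frequency to one. -/
theorem gradSymbol_eq {ξ : E n} (hξ : ξ ≠ 0) {R : E n ≃ₗᵢ[ℝ] E n}
    (hR : R (EuclideanSpace.single 0 1) = ‖ξ‖⁻¹ • ξ) :
    gradSymbol n s ξ = (2 * π * ‖ξ‖) ^ s • R (gradSymbolUnit n s) := by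
  have hρ : 0 < 2 * π * ‖ξ‖ := by positivity
  rw [gradSymbol, ← R.measurePreserving.integral_comp R.toHomeomorph.measurableEmbedding,
    ← map_smul, ← integral_sin_scaled hρ]
  have hcomm := R.toContinuousLinearEquiv.integral_comp_comm
    (fun w : E n => sin (2 * π * ‖ξ‖ * w 0) • gradKernel n s w) (μ := volume)
  refine Eq.trans ?_ hcomm
  refine integral_congr_ae (ae_of_all _ fun w => ?_)
  have hw : inner ℝ ξ (R w) = ‖ξ‖ * w 0 := by
    have h1 : ξ = ‖ξ‖ • R (EuclideanSpace.single 0 1) := by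
      rw [hR, smul_smul, mul_inv_cancel₀ (norm_ne_zero_iff.2 hξ), one_smul]
    conv_lhs => rw [h1]
    rw [inner_smul_left, R.inner_map_map, EuclideanSpace.inner_single_left]
    simp
  simp only [hw, gradKernel_isometry]
  rw [← mul_assoc]
  exact (map_smul R _ _).symm

/-- The integral of an even function that vanishes where `z 0 = 0` is twice its integral over a
half-space. -/
theorem integral_eq_two_mul_halfspace {f : E n → ℝ} (hf : Integrable f)
    (heven : ∀ z, f (-z) = f z) (h0 : ∀ z : E n, z 0 = 0 → f z = 0) :
    ∫ z, f z = 2 * ∫ z, {z : E n | 0 ≤ z 0}.indicator f z := by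
  have hm : MeasurableSet {z : E n | 0 ≤ z 0} :=
    measurableSet_le measurable_const (by fun_prop)
  have hi := hf.indicator hm
  -- Points with `z 0 = 0` are counted in both half-spaces, which is harmless because `f` vanishes
  -- there.
  have hsplit : ∀ z, f z = {z : E n | 0 ≤ z 0}.indicator f z +
      {z : E n | 0 ≤ z 0}.indicator f (-z) := by
    intro z
    simp only [indicator_apply, mem_ofPred_eq, heven, PiLp.neg_apply, Left.nonneg_neg_iff]
    rcases lt_trichotomy (z 0) 0 with h | h | h
    · simp [h.le, h.not_ge]
    · simp [h, h0 z h]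
    · simp [h.le, h.not_ge]
  calc ∫ z, f z = ∫ z, ({z : E n | 0 ≤ z 0}.indicator f z +
      {z : E n | 0 ≤ z 0}.indicator f (-z)) := integral_congr_ae (ae_of_all _ hsplit)
    _ = _ := by
      rw [integral_add hi hi.comp_neg, integral_neg_eq_self, two_mul]

/-- In polar coordinates the radial powers combine to `r^(-(1+s))`, the integral in `r` is
`integral_mul_sin_mul_rpow`, and the angular factor is the hemisphere moment. -/
theorem integral_sin_mul_coord (hs0 : 0 < s) (hs1 : s < 1)
    (hi : Integrable (fun w : E n => w 0 * sin (w 0) * ‖w‖ ^ (-((n : ℝ) + s + 1)))) :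
    ∫ w : E n, w 0 * sin (w 0) * ‖w‖ ^ (-((n : ℝ) + s + 1)) =
      2 * (Gamma (1 - s) / s * sin (π * s / 2) * sphereMoment n s) := by
  have hm : MeasurableSet {z : E n | 0 ≤ z 0} :=
    measurableSet_le measurable_const (by fun_prop)
  have hmS : MeasurableSet {θ : Metric.sphere (0 : E n) 1 | 0 ≤ (θ : E n) 0} :=
    measurableSet_le measurable_const (by fun_prop)
  rw [integral_eq_two_mul_halfspace hi (fun z => by simp) (fun z hz => by simp [hz]),
    integral_eq_integral_sphere_Ioi (hi.indicator hm), sphereMoment,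
    mul_right_inj' two_ne_zero, ← integral_const_mul, ← integral_indicator hmS]
  refine integral_congr_ae (ae_of_all _ fun θ => ?_)
  have hθ : ‖(θ : E n)‖ = 1 := norm_eq_of_mem_sphere θ
  simp only [indicator_apply, mem_ofPred_eq]
  rw [← integral_mul_sin_mul_rpow hs0 hs1]
  split_ifs with h
  · refine setIntegral_congr_fun (μ := volume) measurableSet_Ioi fun r (hr : 0 < r) => ?_
    have h' : 0 ≤ r * (θ : E n) 0 := by positivity
    simp only [PiLp.smul_apply, smul_eq_mul, h', if_true]
    rw [norm_smul, hθ, mul_one, Real.norm_of_nonneg hr.le, ← rpow_natCast r (n - 1),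
      Nat.cast_pred (NeZero.pos n)]
    have : r ^ (-(1 + s)) = r ^ ((n : ℝ) - 1) * r * r ^ (-((n : ℝ) + s + 1)) := by
      rw [← rpow_add_one hr.ne', ← rpow_add hr]
      congr 1; ring
    rw [this]
    ring
  · refine (setIntegral_congr_fun (g := fun _ => (0 : ℝ)) measurableSet_Ioi
      fun r (hr : 0 < r) => ?_).trans (by simp)
    have h' : ¬ 0 ≤ r * (θ : E n) 0 := not_le.2 (mul_neg_of_pos_of_neg hr (not_le.1 h))
    simp only [PiLp.smul_apply, smul_eq_mul, h', if_false, mul_zero]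

theorem inner_sin_smul_gradKernel (w : E n) :
    inner ℝ (EuclideanSpace.single (0 : Fin n) (1 : ℝ)) (sin (w 0) • gradKernel n s w) =
      Comega n s * (w 0 * sin (w 0) * ‖w‖ ^ (-((n : ℝ) + s + 1))) := by
  rcases eq_or_ne w 0 with rfl | hw
  · simp
  have : 0 < ‖w‖ := norm_pos_iff.2 hw
  rw [EuclideanSpace.inner_single_left]
  simp only [gradKernel, PiLp.smul_apply, smul_eq_mul, map_one, one_mul]
  rw [show -((n : ℝ) + s + 1) = -((n : ℝ) + s) - 1 by ring, rpow_sub_one this.ne']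
  field_simp

/-- The component along `e` equals `1` by the choice of `Comega`. The vector is a multiple of `e` by
symmetry, so its norm is `1`. -/
theorem norm_gradSymbolUnit (hs0 : 0 < s) (hs1 : s < 1) : ‖gradSymbolUnit n s‖ = 1 := by
  set e : E n := EuclideanSpace.single 0 1 with he
  have hen : ‖e‖ = 1 := by simp [he]
  have hG1 : 0 < Gamma (1 - s) := Gamma_pos_of_pos (by linarith)
  have hsin : 0 < sin (π * s / 2) := by
    apply sin_pos_of_pos_of_lt_pi <;> nlinarith [pi_pos]
  have hI := sphereMoment_pos (n := n) hs0
  have hint := integrable_sin_coord_smul_gradKernel (n := n) hs0 hs1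
  have hCpos : 0 < Comega n s := by
    rw [Comega, ← sphereMoment]
    positivity
  have hinner : inner ℝ e (gradSymbolUnit n s) = 1 := by
    have hi2 := hint.const_inner (𝕜 := ℝ) e
    simp only [he, inner_sin_smul_gradKernel] at hi2
    rw [gradSymbolUnit, ← integral_inner hint, he]
    simp only [inner_sin_smul_gradKernel]
    rw [integral_const_mul, integral_sin_mul_coord hs0 hs1, Comega, ← sphereMoment]
    · generalize sin (π * s / 2) = a at hsin ⊢
      field_simp
    · refine (hi2.const_mul (Comega n s)⁻¹).congr (ae_of_all _ fun w => ?_)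
      field_simp
  -- Reflection in the line through `e` preserves the coordinate `w 0`, hence fixes the integral;
  -- its fixed vectors are the multiples of `e`.
  set T := (ℝ ∙ e).reflection with hT
  have hTw : ∀ w : E n, (T w) 0 = w 0 := by
    intro w
    have h1 : ∀ x : E n, x 0 = inner ℝ e x := fun x => by
      rw [he, EuclideanSpace.inner_single_left]; simp
    rw [h1, h1]
    conv_lhs => rw [← Submodule.reflection_mem_subspace_eq_self
      (Submodule.mem_span_singleton_self (R := ℝ) e)]
    exact T.inner_map_map e w
  have hfix : T (gradSymbolUnit n s) = gradSymbolUnit n s := by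
    conv_rhs => rw [gradSymbolUnit,
      ← T.measurePreserving.integral_comp T.toHomeomorph.measurableEmbedding]
    simp only [hTw, gradKernel_isometry, ← map_smul]
    exact (T.toContinuousLinearEquiv.integral_comp_comm _).symm
  have hmem := (Submodule.reflection_eq_self_iff _).1 hfix
  obtain ⟨c, hc⟩ := Submodule.mem_span_singleton.1 hmem
  rw [← hc, inner_smul_right, real_inner_self_eq_norm_sq, hen, one_pow, mul_one] at hinner
  rw [← hc, hinner, one_smul, hen]

theorem norm_gradSymbol (hs0 : 0 < s) (hs1 : s < 1) (ξ : E n) :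
    ‖gradSymbol n s ξ‖ = (2 * π * ‖ξ‖) ^ s := by
  rcases eq_or_ne ξ 0 with rfl | hξ
  · simp [gradSymbol, zero_rpow hs0.ne']
  · obtain ⟨R, hR⟩ := exists_isometry_single (v := ‖ξ‖⁻¹ • ξ) (by simp [norm_smul, hξ])
    rw [gradSymbol_eq hξ hR, norm_smul, R.norm_map, norm_gradSymbolUnit hs0 hs1, mul_one,
      Real.norm_of_nonneg (by positivity)]

end

/-! ### Plancherel on `L¹ ∩ L²` and the Gagliardo seminorm on the Fourier side. -/

section

open Set Real FourierTransform

theorem eLpNorm_two_sq {α ε : Type*} {m : MeasurableSpace α} [ENorm ε] (μ : Measure α)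
    (f : α → ε) : eLpNorm f 2 μ ^ 2 = ∫⁻ x, ‖f x‖ₑ ^ 2 ∂μ := by
  have h := eLpNorm_nnreal_pow_eq_lintegral (f := f) (μ := μ) (p := 2) (by norm_num)
  simpa using h

theorem integral_fourier_mul_eq {n : ℕ} {f g : E n → ℂ} (hf : Integrable f) (hg : Integrable g) :
    ∫ ξ, 𝓕 f ξ * g ξ = ∫ x, f x * 𝓕 g x := by
  have h := VectorFourier.integral_fourierIntegral_smul_eq_flip (L := innerₗ (E n))
    (μ := volume) (ν := volume) continuous_fourierChar continuous_inner hf hg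
  simp only [flip_innerₗ, smul_eq_mul] at h
  exact h

/-- The abstract `L²` transform and the Fourier integral agree when tested against smooth compactly
supported functions: in both cases the transform moves onto the test function. -/
theorem fourier_toLp_ae_eq {n : ℕ} {f : E n → ℂ} (h1 : Integrable f) (h2 : MemLp f 2) :
    (𝓕 (h2.toLp f) : Lp (α := E n) ℂ 2 volume) =ᵐ[volume] 𝓕 f := by
  have hc : Continuous (𝓕 f) :=
    VectorFourier.fourierIntegral_continuous continuous_fourierChar continuous_inner h1
  refine ae_eq_of_integral_contDiff_smul_eq
    ((Lp.memLp (𝓕 (h2.toLp f))).locallyIntegrable (by norm_num)) hc.locallyIntegrable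
    fun g hg hgc => ?_
  have hGc : HasCompactSupport (fun x => (g x : ℂ)) := hgc.comp_left Complex.ofReal_zero
  have hGd : ContDiff ℝ (↑(⊤ : ℕ∞)) (fun x => (g x : ℂ)) := Complex.ofRealCLM.contDiff.comp hg
  set G : SchwartzMap (E n) ℂ := hGc.toSchwartzMap hGd with hG
  have hGx : ∀ x, G x = (g x : ℂ) := fun x => rfl
  have e1 := congrArg (fun T => T G) (Lp.fourier_toTemperedDistribution_eq (h2.toLp f))
  simp only [TemperedDistribution.fourier_apply, Lp.toTemperedDistribution_apply] at e1
  calc ∫ x, g x • (𝓕 (h2.toLp f) : Lp (α := E n) ℂ 2 volume) x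
      = ∫ x, G x • (𝓕 (h2.toLp f) : Lp (α := E n) ℂ 2 volume) x := by
        simp only [hGx, Complex.real_smul, smul_eq_mul]
    _ = ∫ x, (𝓕 G) x • (h2.toLp f) x := e1.symm
    _ = ∫ x, 𝓕 (G : E n → ℂ) x * f x := by
        refine integral_congr_ae ?_
        filter_upwards [h2.coeFn_toLp] with x hx
        rw [hx, SchwartzMap.fourier_coe, smul_eq_mul]
    _ = ∫ x, G x * 𝓕 f x := integral_fourier_mul_eq G.integrable h1
    _ = ∫ x, g x • 𝓕 f x := by simp only [hGx, Complex.real_smul]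

/-- Plancherel's theorem for functions in `L¹ ∩ L²`. -/
theorem lintegral_enorm_fourier_sq {n : ℕ} {f : E n → ℂ} (h1 : Integrable f) (h2 : MemLp f 2) :
    ∫⁻ ξ, ‖𝓕 f ξ‖ₑ ^ 2 = ∫⁻ x, ‖f x‖ₑ ^ 2 := by
  rw [← eLpNorm_two_sq, ← eLpNorm_two_sq, ← eLpNorm_congr_ae (fourier_toLp_ae_eq h1 h2),
    ← eLpNorm_congr_ae h2.coeFn_toLp, ← Lp.enorm_def, ← Lp.enorm_def,
    ← ofReal_norm, ← ofReal_norm, Lp.norm_fourier_eq]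

/-- The Fourier transform of a real-valued function. -/
def realFourier {n : ℕ} (u : E n → ℝ) (ξ : E n) : ℂ := 𝓕 (fun x => (u x : ℂ)) ξ

theorem continuous_realFourier {n : ℕ} {u : E n → ℝ} (hu : Integrable u) :
    Continuous (realFourier u) :=
  VectorFourier.fourierIntegral_continuous continuous_fourierChar continuous_inner hu.ofReal

theorem lintegral_enorm_realFourier_sq {n : ℕ} {u : E n → ℝ} (h1 : Integrable u)
    (h2 : MemLp u 2) : ∫⁻ ξ, ‖realFourier u ξ‖ₑ ^ 2 = ∫⁻ x, ‖u x‖ₑ ^ 2 := by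
  have h := lintegral_enorm_fourier_sq (f := fun x => (u x : ℂ)) h1.ofReal h2.ofReal
  have e : ∀ r : ℝ, ‖(r : ℂ)‖ₑ = ‖r‖ₑ := fun r => by
    rw [← ofReal_norm, ← ofReal_norm, Complex.norm_real]
  simpa only [e] using! h

theorem enorm_exp_sub_one_sq (a : ℝ) :
    ‖Complex.exp (a * Complex.I) - 1‖ₑ ^ 2 = ENNReal.ofReal (2 - 2 * cos a) := by
  rw [← ofReal_norm, ← ENNReal.ofReal_pow (norm_nonneg _), ← Complex.normSq_eq_norm_sq,
    Complex.normSq_apply, Complex.exp_mul_I]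
  congr 1
  simp [← Complex.ofReal_cos, ← Complex.ofReal_sin]
  nlinarith [sin_sq_add_cos_sq a]

/-- Translation by `z` multiplies the transform by `exp(2πi ξ·z)`, and `|exp(ia) - 1|² = 2 - 2 cos
a`. -/
theorem lintegral_enorm_translate_sub_sq {n : ℕ} {u : E n → ℝ} (h1 : Integrable u)
    (h2 : MemLp u 2) (z : E n) :
    ∫⁻ x, ‖u (x + z) - u x‖ₑ ^ 2 =
      ∫⁻ ξ, ENNReal.ofReal (2 - 2 * cos (2 * π * inner ℝ ξ z)) * ‖realFourier u ξ‖ₑ ^ 2 := by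
  have hmp := measurePreserving_add_right (volume : Measure (E n)) z
  have h1' : Integrable fun x => u (x + z) := h1.comp_add_right z
  have h2' : MemLp (fun x => u (x + z)) 2 := h2.comp_measurePreserving hmp
  refine (lintegral_enorm_realFourier_sq (h1'.sub h1) (h2'.sub h2)).symm.trans ?_
  refine lintegral_congr fun ξ => ?_
  have htr : 𝓕 (fun x => (u (x + z) : ℂ)) ξ = fourierChar (inner ℝ z ξ) • 𝓕 (fun x => (u x : ℂ)) ξ :=
    congrFun (VectorFourier.fourierIntegral_comp_add_right fourierChar volume (innerₗ (E n))
      (fun x => (u x : ℂ)) z) ξ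
  have hsub : realFourier (fun x => u (x + z) - u x) ξ =
      𝓕 (fun x => (u (x + z) : ℂ)) ξ - 𝓕 (fun x => (u x : ℂ)) ξ := by
    rw [realFourier, fourier_eq, fourier_eq, fourier_eq, ← integral_sub]
    · simp only [Complex.ofReal_sub, smul_sub]
    · exact (fourierIntegral_convergent_iff ξ).2 h1'.ofReal
    · exact (fourierIntegral_convergent_iff ξ).2 h1.ofReal
  have hfac : realFourier (fun x => u (x + z) - u x) ξ =
      (Complex.exp ((2 * π * inner ℝ ξ z : ℝ) * Complex.I) - 1) * realFourier u ξ := by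
    rw [hsub, htr, Circle.smul_def, fourierChar_apply, smul_eq_mul, realFourier, sub_mul, one_mul,
      real_inner_comm]
  change ‖realFourier (fun x => u (x + z) - u x) ξ‖ₑ ^ 2 = _
  rw [hfac, enorm_mul, mul_pow, enorm_exp_sub_one_sq]

/-- The Gagliardo seminorm in terms of the Fourier transform. -/
theorem gagliardo_eq_lintegral_fourier {n : ℕ} [NeZero n] {s : ℝ} (hs0 : 0 < s) (hs1 : s < 1)
    {u : E n → ℝ} (hm : Measurable u) (h1 : Integrable u) (h2 : MemLp u 2) :
    gagliardo s u = ENNReal.ofReal (2 / Cns n s) *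
      ∫⁻ ξ, ENNReal.ofReal ((2 * π * ‖ξ‖) ^ (2 * s)) * ‖realFourier u ξ‖ₑ ^ 2 := by
  have hC := Cns_pos n hs0 hs1
  have hft := (continuous_realFourier h1).measurable
  -- With `y = x + z`, Plancherel in `x` at fixed `z` decouples the problem; the remaining integral
  -- in `z` is the symbol of the fractional Laplacian.
  calc gagliardo s u
      = ∫⁻ x, ∫⁻ z, ENNReal.ofReal ((‖z‖ ^ ((n : ℝ) + 2 * s))⁻¹) * ‖u (x + z) - u x‖ₑ ^ 2 := by
        refine lintegral_congr fun x => ?_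
        rw [← lintegral_add_left_eq_self _ x]
        refine lintegral_congr fun z => ?_
        rw [← ofReal_norm, ← ENNReal.ofReal_pow (norm_nonneg _),
          ← ENNReal.ofReal_mul (by positivity), sub_add_cancel_left, norm_neg, norm_eq_abs,
          abs_sub_comm]
        congr 1
        ring
    _ = ∫⁻ z, ∫⁻ x, ENNReal.ofReal ((‖z‖ ^ ((n : ℝ) + 2 * s))⁻¹) * ‖u (x + z) - u x‖ₑ ^ 2 := by
        refine lintegral_lintegral_swap (Measurable.aemeasurable ?_)
        simp only [Function.uncurry_def]
        fun_prop
    _ = ∫⁻ z, ∫⁻ ξ, ENNReal.ofReal ((2 - 2 * cos (2 * π * inner ℝ ξ z)) /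
          ‖z‖ ^ ((n : ℝ) + 2 * s)) * ‖realFourier u ξ‖ₑ ^ 2 := by
        refine lintegral_congr fun z => ?_
        rw [lintegral_const_mul' _ _ ENNReal.ofReal_ne_top, lintegral_enorm_translate_sub_sq h1 h2,
          ← lintegral_const_mul' _ _ ENNReal.ofReal_ne_top]
        refine lintegral_congr fun ξ => ?_
        rw [← mul_assoc, ← ENNReal.ofReal_mul (by positivity)]
        congr 2
        ring
    _ = ∫⁻ ξ, ∫⁻ z, ENNReal.ofReal ((2 - 2 * cos (2 * π * inner ℝ ξ z)) /
          ‖z‖ ^ ((n : ℝ) + 2 * s)) * ‖realFourier u ξ‖ₑ ^ 2 := by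
        refine lintegral_lintegral_swap (Measurable.aemeasurable ?_)
        simp only [Function.uncurry_def]
        fun_prop
    _ = _ := by
        rw [← lintegral_const_mul' _ _ ENNReal.ofReal_ne_top]
        refine lintegral_congr fun ξ => ?_
        rw [lintegral_mul_const' _ _ (by finiteness), lintegral_two_sub_two_cos_div hs0 hs1,
          ENNReal.ofReal_mul (by positivity), mul_assoc]

end

/-! ### Convolution with bounded integrable odd vector kernels. -/

section

open Set Real FourierTransform

theorem enorm_sq_eq_sum {n : ℕ} (v : E n) : ‖v‖ₑ ^ 2 = ∑ j, ‖v j‖ₑ ^ 2 := by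
  rw [← ofReal_norm, ← ENNReal.ofReal_pow (norm_nonneg _), EuclideanSpace.norm_sq_eq,
    ENNReal.ofReal_sum_of_nonneg fun _ _ => by positivity]
  simp only [ENNReal.ofReal_pow (norm_nonneg _), ofReal_norm]

theorem integral_euclidean_apply {n : ℕ} {α : Type*} {m : MeasurableSpace α} {μ : Measure α}
    {f : α → E n} (hf : Integrable f μ) (j : Fin n) : (∫ x, f x ∂μ) j = ∫ x, f x j ∂μ :=
  ((EuclideanSpace.proj (𝕜 := ℝ) j).integral_comp_comm hf).symm

/-- The cosine part integrates to zero against an odd function, so only the sine part survives. -/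
theorem fourier_odd {n : ℕ} {k : E n → ℝ} (hk : Integrable k) (hodd : ∀ z, k (-z) = -k z)
    (ξ : E n) :
    realFourier k ξ = -Complex.I * ((∫ z, sin (2 * π * inner ℝ ξ z) * k z : ℝ) : ℂ) := by
  have hb : Integrable fun z => cos (2 * π * inner ℝ ξ z) * k z :=
    hk.bdd_mul (c := 1) (Measurable.aestronglyMeasurable (by fun_prop))
      (ae_of_all _ fun z => abs_cos_le_one _)
  have hs : Integrable fun z => sin (2 * π * inner ℝ ξ z) * k z :=
    hk.bdd_mul (c := 1) (Measurable.aestronglyMeasurable (by fun_prop))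
      (ae_of_all _ fun z => abs_sin_le_one _)
  have hcos : ∫ z, cos (2 * π * inner ℝ ξ z) * k z = 0 := by
    have h := integral_neg_eq_self (fun z => cos (2 * π * inner ℝ ξ z) * k z) volume
    simp only [inner_neg_right, mul_neg, cos_neg, hodd, integral_neg] at h
    linarith
  rw [realFourier, fourier_eq']
  have e : ∀ z, Complex.exp (((-2 * π * inner ℝ z ξ : ℝ) : ℂ) * Complex.I) • (k z : ℂ) =
      ((cos (2 * π * inner ℝ ξ z) * k z : ℝ) : ℂ) -
        Complex.I * ((sin (2 * π * inner ℝ ξ z) * k z : ℝ) : ℂ) := by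
    intro z
    rw [Complex.exp_mul_I, real_inner_comm, ← Complex.ofReal_cos, ← Complex.ofReal_sin,
      show -2 * π * inner ℝ ξ z = -(2 * π * inner ℝ ξ z) by ring, cos_neg, sin_neg, smul_eq_mul]
    push_cast
    ring
  simp only [e]
  rw [integral_sub hb.ofReal (hs.ofReal.const_mul _), integral_const_mul,
    integral_complex_ofReal, integral_complex_ofReal, hcos]
  simp

theorem memLp_two_of_integrable_of_bound {α F : Type*} [NormedAddCommGroup F]
    {m : MeasurableSpace α} {μ : Measure α} {f : α → F} (hf : Integrable f μ) {C : ℝ}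
    (hC : ∀ x, ‖f x‖ ≤ C) : MemLp f 2 μ := by
  rw [memLp_two_iff_integrable_sq_norm hf.aestronglyMeasurable]
  refine (hf.norm.const_mul C).mono' (hf.aestronglyMeasurable.norm.pow 2)
    (ae_of_all _ fun x => ?_)
  rw [norm_pow, norm_norm, sq]
  exact mul_le_mul_of_nonneg_right (hC x) (norm_nonneg _)

section OddKernel

variable {n : ℕ} {k : E n → E n} {u : E n → ℝ} {M : ℝ}

theorem integrable_smul_kernel (hk : AEStronglyMeasurable k) (hM : ∀ z, ‖k z‖ ≤ M)
    (hu : Integrable u) (x : E n) : Integrable fun y => u y • k (y - x) := by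
  have := hk.comp_measurePreserving (measurePreserving_sub_right volume x)
  refine (hu.norm.const_mul M).mono' (hu.aestronglyMeasurable.smul this) (ae_of_all _ fun y => ?_)
  rw [norm_smul, mul_comm]
  exact mul_le_mul_of_nonneg_right (hM _) (norm_nonneg _)

/-- Oddness turns the correlation with `k` into minus a convolution, componentwise, so that the
convolution theorem applies. -/
theorem integral_smul_kernel_apply (hk : Integrable k) (hM : ∀ z, ‖k z‖ ≤ M)
    (hodd : ∀ z, k (-z) = -k z) (hu : Integrable u) (x : E n) (j : Fin n) :
    (∫ y, u y • k (y - x)) j =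
      -convolution u (fun z => k z j) (ContinuousLinearMap.mul ℝ ℝ) volume x := by
  rw [integral_euclidean_apply (integrable_smul_kernel hk.aestronglyMeasurable hM hu x),
    convolution_def, ← integral_neg]
  refine integral_congr_ae (ae_of_all _ fun y => ?_)
  have : k (y - x) = -k (x - y) := by rw [← hodd, neg_sub]
  simp [this]

theorem integrable_integral_smul_kernel (hk : Integrable k) (hM : ∀ z, ‖k z‖ ≤ M)
    (hodd : ∀ z, k (-z) = -k z) (hu : Integrable u) :
    Integrable fun x => ∫ y, u y • k (y - x) := by
  refine Integrable.of_eval_piLp fun j => ?_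
  simp only [integral_smul_kernel_apply hk hM hodd hu]
  exact (hu.integrable_convolution _ (hk.eval_piLp j)).neg

theorem memLp_integral_smul_kernel (hk : Integrable k) (hM : ∀ z, ‖k z‖ ≤ M)
    (hodd : ∀ z, k (-z) = -k z) (hu : Integrable u) :
    MemLp (fun x => ∫ y, u y • k (y - x)) 2 := by
  refine memLp_two_of_integrable_of_bound (integrable_integral_smul_kernel hk hM hodd hu)
    (C := ∫ y, M * ‖u y‖) fun x => ?_
  refine norm_integral_le_of_norm_le (hu.norm.const_mul M) (ae_of_all _ fun y => ?_)
  rw [norm_smul, mul_comm]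
  exact mul_le_mul_of_nonneg_right (hM _) (norm_nonneg _)

/-- Plancherel in each component: by the convolution theorem and `fourier_odd` the multiplier is `i`
times the sine integral of `k`. -/
theorem lintegral_enorm_integral_smul_kernel_sq (hk : Integrable k) (hM : ∀ z, ‖k z‖ ≤ M)
    (hodd : ∀ z, k (-z) = -k z) (hu : Integrable u) :
    ∫⁻ x, ‖∫ y, u y • k (y - x)‖ₑ ^ 2 =
      ∫⁻ ξ, ‖∫ z, sin (2 * π * inner ℝ ξ z) • k z‖ₑ ^ 2 * ‖realFourier u ξ‖ₑ ^ 2 := by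
  have hgi := integrable_integral_smul_kernel hk hM hodd hu
  have hg2 := memLp_integral_smul_kernel hk hM hodd hu
  have hsk : ∀ ξ : E n, Integrable fun z => sin (2 * π * inner ℝ ξ z) • k z := fun ξ =>
    hk.bdd_smul (φ := fun z => sin (2 * π * inner ℝ ξ z)) 1 (Measurable.aestronglyMeasurable (by fun_prop))
      (ae_of_all _ fun z => abs_sin_le_one _)
  have hk_apply : ∀ j, Integrable fun z => k z j := fun j => hk.eval_piLp j
  have hsymb : ∀ j ξ, ‖(∫ z, sin (2 * π * inner ℝ ξ z) • k z) j‖ₑ ^ 2 * ‖realFourier u ξ‖ₑ ^ 2 =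
      ‖realFourier (fun x => (∫ y, u y • k (y - x)) j) ξ‖ₑ ^ 2 := by
    intro j ξ
    have h1 : realFourier (fun x => (∫ y, u y • k (y - x)) j) ξ =
        -(realFourier u ξ * realFourier (fun z => k z j) ξ) := by
      refine Eq.trans ?_ (congrArg Neg.neg (fourier_mul_convolution_eq
        (hu.ofReal (𝕜 := ℂ)) ((hk_apply j).ofReal (𝕜 := ℂ)) ξ))
      rw [realFourier, fourier_eq, fourier_eq, ← integral_neg]
      refine integral_congr_ae (ae_of_all _ fun x => ?_)
      simp only [integral_smul_kernel_apply hk hM hodd hu, convolution_def,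
        ContinuousLinearMap.mul_apply']
      rw [← smul_neg, Complex.ofReal_neg, ← integral_complex_ofReal]
      simp
    rw [h1, fourier_odd (hk_apply j) (fun z => by simp [hodd]), enorm_neg, enorm_mul, enorm_mul,
      integral_euclidean_apply (hsk ξ)]
    have hI : ‖-Complex.I‖ₑ = 1 := by simp [← ofReal_norm]
    have hr : ∀ r : ℝ, ‖(r : ℂ)‖ₑ = ‖r‖ₑ := fun r => by
      rw [← ofReal_norm, ← ofReal_norm, Complex.norm_real]
    rw [hI, hr, one_mul, mul_pow, mul_comm]
    simp only [PiLp.smul_apply, smul_eq_mul]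
  have hmeas : ∀ j, Measurable fun ξ =>
      ‖realFourier (fun x => (∫ y, u y • k (y - x)) j) ξ‖ₑ ^ 2 := fun j =>
    ((continuous_realFourier (hgi.eval_piLp j)).measurable.enorm).pow_const 2
  simp only [enorm_sq_eq_sum, Finset.sum_mul, hsymb]
  rw [lintegral_finsetSum _ fun j _ => hmeas j, lintegral_finsetSum']
  · refine Finset.sum_congr rfl fun j _ => ?_
    exact (lintegral_enorm_realFourier_sq (hgi.eval_piLp j)
      ((EuclideanSpace.proj (𝕜 := ℝ) j).comp_memLp' hg2)).symm
  · exact fun j _ => ((hgi.eval_piLp j).aestronglyMeasurable.enorm).pow_const 2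

end OddKernel

end

/-! ### Truncated gradients on the Fourier side and their limit. -/

section

open Set Real

variable {n : ℕ} [NeZero n] {s : ℝ}

/-- The kernel of the fractional gradient truncated to `ε < ‖z‖`. -/
def truncKernel (n : ℕ) [NeZero n] (s ε : ℝ) : E n → E n :=
  {z | ε < ‖z‖}.indicator (gradKernel n s)

theorem truncKernel_neg (ε : ℝ) (z : E n) : truncKernel n s ε (-z) = -truncKernel n s ε z := by
  simp only [truncKernel, indicator_apply, mem_ofPred_eq, norm_neg, gradKernel_neg]
  split_ifs <;> simp

theorem measurable_truncKernel (ε : ℝ) : Measurable (truncKernel n s ε) :=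
  measurable_gradKernel.indicator (measurableSet_lt_norm ε)

theorem norm_truncKernel_le (hs0 : 0 < s) {ε : ℝ} (hε : 0 < ε) (z : E n) :
    ‖truncKernel n s ε z‖ ≤ |Comega n s| * ε ^ (-((n : ℝ) + s)) := by
  simp only [truncKernel, indicator_apply, mem_ofPred_eq]
  split_ifs with h
  · refine (norm_gradKernel_le z).trans ?_
    have : -((n : ℝ) + s) ≤ 0 := by
      have : (0 : ℝ) ≤ n := n.cast_nonneg
      linarith
    have := rpow_le_rpow_of_nonpos hε h.le this
    gcongr
  · rw [norm_zero]; positivity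

theorem integrable_truncKernel (hs0 : 0 < s) (hs1 : s < 1) {ε : ℝ} (hε : 0 < ε) :
    Integrable (truncKernel n s ε) := by
  -- Where `ε < ‖z‖` one has `min 1 ε ≤ min 1 ‖z‖`, so the factor `(min 1 ε)⁻¹` makes the earlier
  -- majorant sufficient.
  refine ((integrable_min_mul_rpow_norm (n := n) hs0 hs1).const_mul
    (|Comega n s| * (min 1 ε)⁻¹)).mono' (measurable_truncKernel ε).aestronglyMeasurable
    (ae_of_all _ fun z => ?_)
  simp only [truncKernel, indicator_apply, mem_ofPred_eq]
  split_ifs with h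
  · refine (norm_gradKernel_le z).trans ?_
    have h1 : 1 ≤ (min 1 ε)⁻¹ * min 1 ‖z‖ := by
      rw [inv_mul_eq_div, one_le_div (by positivity)]
      exact min_le_min_left _ h.le
    calc |Comega n s| * ‖z‖ ^ (-((n : ℝ) + s))
        = |Comega n s| * 1 * ‖z‖ ^ (-((n : ℝ) + s)) := by rw [mul_one]
      _ ≤ |Comega n s| * ((min 1 ε)⁻¹ * min 1 ‖z‖) * ‖z‖ ^ (-((n : ℝ) + s)) := by gcongr
      _ = _ := by ring
  · rw [norm_zero]; positivity

/-- By oddness. This removes the term with `u x` from the truncated gradient, leaving a pure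
convolution of `u`. -/
theorem integral_truncKernel (ε : ℝ) (x : E n) : ∫ y, truncKernel n s ε (y - x) = 0 := by
  rw [integral_sub_right_eq_self (truncKernel n s ε) x]
  have h := integral_neg_eq_self (truncKernel n s ε) volume
  simp only [truncKernel_neg, integral_neg] at h
  have h2 : (2 : ℝ) • ∫ y, truncKernel n s ε y = 0 := by
    rw [two_smul]
    nth_rewrite 1 [← h]
    exact neg_add_cancel _
  exact (smul_eq_zero.1 h2).resolve_left two_ne_zero

/-- The truncated fractional gradient. -/
abbrev truncGrad (n : ℕ) [NeZero n] (s ε : ℝ) (u : E n → ℝ) (x : E n) : E n :=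
  truncatedGradient (fracWeight n s) (fracKernel n) ε u x

theorem truncGrad_eq_integral_sub (ε : ℝ) (u : E n → ℝ) (x : E n) :
    truncGrad n s ε u x = ∫ y, (u y - u x) • truncKernel n s ε (y - x) := by
  have hm : MeasurableSet {y : E n | ε < ‖y - x‖} :=
    measurableSet_lt measurable_const (by fun_prop)
  rw [truncGrad, truncatedGradient, ← integral_indicator hm]
  refine integral_congr_ae (ae_of_all _ fun y => ?_)
  simp only [indicator_apply, mem_ofPred_eq, truncKernel, fracWeight_smul_fracKernel, smul_ite,
    smul_zero]

theorem truncGrad_eq (hs0 : 0 < s) (hs1 : s < 1) {ε : ℝ} (hε : 0 < ε)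
    {u : E n → ℝ} (hu : Integrable u) (x : E n) :
    truncGrad n s ε u x = ∫ y, u y • truncKernel n s ε (y - x) := by
  have hi : Integrable fun y => u x • truncKernel n s ε (y - x) :=
    ((integrable_truncKernel hs0 hs1 hε).comp_sub_right x).smul (u x)
  rw [truncGrad_eq_integral_sub]
  simp only [sub_smul]
  rw [integral_sub (integrable_smul_kernel (measurable_truncKernel ε).aestronglyMeasurable
    (norm_truncKernel_le hs0 hε) hu x) hi, integral_smul, integral_truncKernel, smul_zero,
    sub_zero]

theorem memLp_truncGrad (hs0 : 0 < s) (hs1 : s < 1) {ε : ℝ} (hε : 0 < ε)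
    {u : E n → ℝ} (hu : Integrable u) : MemLp (truncGrad n s ε u) 2 := by
  have h := memLp_integral_smul_kernel (integrable_truncKernel hs0 hs1 hε)
    (norm_truncKernel_le hs0 hε) (truncKernel_neg ε) hu
  exact h.ae_eq (ae_of_all _ fun x => (truncGrad_eq hs0 hs1 hε hu x).symm)

theorem truncSymbol_eq_integral (ε : ℝ) (ξ : E n) :
    truncSymbol n s ε ξ = ∫ z, sin (2 * π * inner ℝ ξ z) • truncKernel n s ε z := by
  rw [truncSymbol, ← integral_indicator (measurableSet_lt_norm ε)]
  refine integral_congr_ae (ae_of_all _ fun z => ?_)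
  simp only [indicator_apply, mem_ofPred_eq, truncKernel, smul_ite, smul_zero]

theorem integrable_sin_smul_truncKernel (hs0 : 0 < s) (hs1 : s < 1) (ε : ℝ) (ξ : E n) :
    Integrable fun z => sin (2 * π * inner ℝ ξ z) • truncKernel n s ε z := by
  refine ((integrable_sin_smul_gradKernel hs0 hs1 ξ).indicator (measurableSet_lt_norm ε)).congr
    (ae_of_all _ fun z => ?_)
  simp only [indicator_apply, mem_ofPred_eq, truncKernel, smul_ite, smul_zero]

/-- The density, on the Fourier side, of the truncated gradient. -/
def truncDensity (n : ℕ) [NeZero n] (s ε : ℝ) (u : E n → ℝ) (ξ : E n) : E n :=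
  ‖realFourier u ξ‖ • truncSymbol n s ε ξ

/-- The density, on the Fourier side, of the gradient. -/
def gradDensity (n : ℕ) [NeZero n] (s : ℝ) (u : E n → ℝ) (ξ : E n) : E n :=
  ‖realFourier u ξ‖ • gradSymbol n s ξ

/-- Norms see only the modulus of the transform of `u`, so the densities carry this modulus as a
real factor and stay in `E n`. -/
theorem eLpNorm_truncGrad (hs0 : 0 < s) (hs1 : s < 1) {ε : ℝ} (hε : 0 < ε)
    {u : E n → ℝ} (hu : Integrable u) :
    eLpNorm (truncGrad n s ε u) 2 volume = eLpNorm (truncDensity n s ε u) 2 volume := by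
  refine (ENNReal.pow_right_strictMono two_ne_zero).injective ?_
  simp only [eLpNorm_two_sq, truncGrad_eq hs0 hs1 hε hu]
  rw [lintegral_enorm_integral_smul_kernel_sq (integrable_truncKernel hs0 hs1 hε)
    (norm_truncKernel_le hs0 hε) (truncKernel_neg ε) hu]
  refine lintegral_congr fun ξ => ?_
  rw [← truncSymbol_eq_integral, truncDensity, enorm_smul, enorm_norm, mul_pow, mul_comm]

/-- The difference is again a convolution with an odd kernel, and both densities share the same
scalar factor. Distances are therefore preserved, not only norms. -/
theorem eLpNorm_truncGrad_sub (hs0 : 0 < s) (hs1 : s < 1) {ε δ : ℝ} (hε : 0 < ε) (hδ : 0 < δ)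
    {u : E n → ℝ} (hu : Integrable u) :
    eLpNorm (truncGrad n s ε u - truncGrad n s δ u) 2 volume =
      eLpNorm (truncDensity n s ε u - truncDensity n s δ u) 2 volume := by
  refine (ENNReal.pow_right_strictMono two_ne_zero).injective ?_
  have hsub : ∀ x, (truncGrad n s ε u - truncGrad n s δ u) x =
      ∫ y, u y • (truncKernel n s ε (y - x) - truncKernel n s δ (y - x)) := by
    intro x
    simp only [smul_sub]
    rw [integral_sub (integrable_smul_kernel (measurable_truncKernel ε).aestronglyMeasurable
      (norm_truncKernel_le hs0 hε) hu x) (integrable_smul_kernel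
      (measurable_truncKernel δ).aestronglyMeasurable (norm_truncKernel_le hs0 hδ) hu x),
      Pi.sub_apply, truncGrad_eq hs0 hs1 hε hu, truncGrad_eq hs0 hs1 hδ hu]
  simp only [eLpNorm_two_sq, hsub]
  have h := lintegral_enorm_integral_smul_kernel_sq (n := n)
    (k := fun z => truncKernel n s ε z - truncKernel n s δ z)
    ((integrable_truncKernel hs0 hs1 hε).sub (integrable_truncKernel hs0 hs1 hδ))
    (fun z => (norm_sub_le _ _).trans
      (add_le_add (norm_truncKernel_le hs0 hε z) (norm_truncKernel_le hs0 hδ z)))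
    (fun z => by simp only [truncKernel_neg]; abel) hu
  rw [h]
  refine lintegral_congr fun ξ => ?_
  simp only [smul_sub]
  rw [integral_sub (integrable_sin_smul_truncKernel hs0 hs1 ε ξ)
    (integrable_sin_smul_truncKernel hs0 hs1 δ ξ), ← truncSymbol_eq_integral,
    ← truncSymbol_eq_integral, Pi.sub_apply, truncDensity, truncDensity, ← smul_sub, enorm_smul,
    enorm_norm, mul_pow, mul_comm]

theorem measurable_truncSymbol (ε : ℝ) : Measurable (truncSymbol n s ε) := by
  have := measurable_gradKernel (n := n) (s := s)
  have h : StronglyMeasurable (Function.uncurry fun (ξ z : E n) =>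
      sin (2 * π * inner ℝ ξ z) • gradKernel n s z) := by
    refine Measurable.stronglyMeasurable ?_
    simp only [Function.uncurry_def]
    fun_prop
  exact (h.integral_prod_right (ν := volume.restrict {z : E n | ε < ‖z‖})).measurable

theorem measurable_gradSymbol : Measurable (gradSymbol n s) := by
  have := measurable_gradKernel (n := n) (s := s)
  have h : StronglyMeasurable (Function.uncurry fun (ξ z : E n) =>
      sin (2 * π * inner ℝ ξ z) • gradKernel n s z) := by
    refine Measurable.stronglyMeasurable ?_
    simp only [Function.uncurry_def]
    fun_prop
  exact (h.integral_prod_right (ν := volume)).measurable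

/-- Both sides are the integral of `(2π‖ξ‖)^(2s)` against the squared modulus of the transform; this
is where the constant `Cns n s / 2` arises. -/
theorem lintegral_enorm_gradDensity_sq (hs0 : 0 < s) (hs1 : s < 1)
    {u : E n → ℝ} (hm : Measurable u) (h1 : Integrable u) (h2 : MemLp u 2) :
    eLpNorm (gradDensity n s u) 2 volume ^ 2 = ENNReal.ofReal (Cns n s / 2) * gagliardo s u := by
  have hC := Cns_pos n hs0 hs1
  rw [gagliardo_eq_lintegral_fourier hs0 hs1 hm h1 h2, ← mul_assoc,
    ← ENNReal.ofReal_mul (by positivity), div_mul_div_cancel₀ (by norm_num), div_self hC.ne',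
    ENNReal.ofReal_one, one_mul, eLpNorm_two_sq]
  refine lintegral_congr fun ξ => ?_
  rw [gradDensity, enorm_smul, enorm_norm, mul_pow, mul_comm, ← ofReal_norm (gradSymbol n s ξ),
    norm_gradSymbol hs0 hs1, ← ENNReal.ofReal_pow (by positivity), ← rpow_natCast,
    ← rpow_mul (by positivity), mul_comm s]
  norm_num

theorem memLp_gradDensity (hs0 : 0 < s) (hs1 : s < 1)
    {u : E n → ℝ} (hm : Measurable u) (h1 : Integrable u) (h2 : MemLp u 2)
    (hg : gagliardo s u < ⊤) : MemLp (gradDensity n s u) 2 := by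
  have := (continuous_realFourier h1).measurable
  have := measurable_gradSymbol (n := n) (s := s)
  refine ⟨Measurable.aestronglyMeasurable (by unfold gradDensity; fun_prop), ?_⟩
  have h := lintegral_enorm_gradDensity_sq hs0 hs1 hm h1 h2
  by_contra hn
  rw [not_lt, top_le_iff] at hn
  rw [hn, ENNReal.top_pow two_ne_zero] at h
  exact (ENNReal.mul_lt_top ENNReal.ofReal_lt_top hg).ne h.symm

theorem norm_truncDensity_le (hs0 : 0 < s) (hs1 : s < 1) (ε : ℝ) (u : E n → ℝ) (ξ : E n) :
    ‖truncDensity n s ε u ξ‖ ≤ symbolBound n s * ‖gradDensity n s u ξ‖ := by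
  rw [truncDensity, gradDensity, norm_smul, norm_smul, norm_norm, norm_gradSymbol hs0 hs1]
  have := norm_truncSymbol_le hs0 hs1 ε ξ
  calc _ ≤ ‖realFourier u ξ‖ * (symbolBound n s * (2 * π * ‖ξ‖) ^ s) := by gcongr
    _ = _ := by ring

theorem measurable_truncDensity (ε : ℝ) {u : E n → ℝ} (h1 : Integrable u) :
    Measurable (truncDensity n s ε u) := by
  have := (continuous_realFourier h1).measurable
  have := measurable_truncSymbol (n := n) (s := s) ε
  unfold truncDensity
  fun_prop

theorem tendsto_truncDensity (hs0 : 0 < s) (hs1 : s < 1) (u : E n → ℝ) (ξ : E n) :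
    Tendsto (fun ε => truncDensity n s ε u ξ) (𝓝[>] 0) (𝓝 (gradDensity n s u ξ)) :=
  (tendsto_truncSymbol hs0 hs1 ξ).const_smul _

theorem memLp_truncDensity (hs0 : 0 < s) (hs1 : s < 1) {ε : ℝ} (hε : 0 < ε)
    {u : E n → ℝ} (h1 : Integrable u) : MemLp (truncDensity n s ε u) 2 :=
  ⟨(measurable_truncDensity ε h1).aestronglyMeasurable,
    eLpNorm_truncGrad hs0 hs1 hε h1 ▸ (memLp_truncGrad hs0 hs1 hε h1).2⟩

theorem tendsto_zero_of_sq {α : Type*} {l : Filter α} {f : α → ℝ≥0∞}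
    (h : Tendsto (fun a => f a ^ 2) l (𝓝 0)) : Tendsto f l (𝓝 0) := by
  have h2 := h.ennrpow_const (1 / 2 : ℝ)
  have e : ∀ a, (f a ^ 2) ^ (1 / 2 : ℝ) = f a := fun a => by
    rw [← ENNReal.rpow_natCast, ← ENNReal.rpow_mul]
    norm_num
  simpa only [e, ENNReal.zero_rpow_of_pos (show (0 : ℝ) < 1 / 2 by norm_num)] using h2

/-- Dominated convergence: the truncated symbols converge pointwise, and each truncated density is
at most `symbolBound n s` times the full one, which is in `L²`. -/
theorem tendsto_eLpNorm_truncDensity_sub (hs0 : 0 < s) (hs1 : s < 1)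
    {u : E n → ℝ} (hm : Measurable u) (h1 : Integrable u) (h2 : MemLp u 2)
    (hg : gagliardo s u < ⊤) :
    Tendsto (fun ε => eLpNorm (truncDensity n s ε u - gradDensity n s u) 2 volume)
      (𝓝[>] 0) (𝓝 0) := by
  refine tendsto_zero_of_sq ?_
  simp only [eLpNorm_two_sq]
  have hM := memLp_gradDensity hs0 hs1 hm h1 h2 hg
  have hgm : Measurable (gradDensity n s u) := by
    have := (continuous_realFourier h1).measurable
    have := measurable_gradSymbol (n := n) (s := s)
    unfold gradDensity
    fun_prop
  rw [← lintegral_zero (μ := (volume : Measure (E n)))]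
  refine tendsto_lintegral_filter_of_dominated_convergence
    (fun ξ => ENNReal.ofReal ((symbolBound n s + 1) ^ 2) * ‖gradDensity n s u ξ‖ₑ ^ 2)
    (Eventually.of_forall fun ε =>
      ((measurable_truncDensity ε h1).sub hgm).enorm.pow_const 2)
    (Eventually.of_forall fun ε => ae_of_all _ fun ξ => ?_) ?_ (ae_of_all _ fun ξ => ?_)
  · rw [← ofReal_norm, ← ofReal_norm, ← ENNReal.ofReal_pow (norm_nonneg _),
      ← ENNReal.ofReal_pow (norm_nonneg _), ← ENNReal.ofReal_mul (by positivity), ← mul_pow]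
    refine ENNReal.ofReal_le_ofReal (pow_le_pow_left₀ (norm_nonneg _) ?_ 2)
    refine (norm_sub_le _ _).trans ?_
    rw [add_mul, one_mul]
    exact add_le_add_left (norm_truncDensity_le hs0 hs1 ε u ξ) _
  · rw [lintegral_const_mul' _ _ ENNReal.ofReal_ne_top, ← eLpNorm_two_sq]
    exact (ENNReal.mul_lt_top ENNReal.ofReal_lt_top (ENNReal.pow_lt_top hM.2)).ne
  · have h := ENNReal.Tendsto.pow (n := 2)
      ((tendsto_truncDensity hs0 hs1 u ξ).sub_const (gradDensity n s u ξ)).enorm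
    simpa using h

end

/-! ### Existence, uniqueness, integral formula and linearity of the fractional gradient. -/

section

open Set Real

variable {n : ℕ} [NeZero n] {s : ℝ}

theorem eventually_pos_nhdsGT : ∀ᶠ ε : ℝ in 𝓝[>] 0, 0 < ε := self_mem_nhdsWithin

theorem tendsto_one_div_nhdsGT :
    Tendsto (fun k : ℕ => 1 / ((k : ℝ) + 1)) atTop (𝓝[>] 0) :=
  tendsto_nhdsWithin_iff.2 ⟨tendsto_one_div_add_atTop_nhds_zero_nat,
    Eventually.of_forall fun k => by simp only [mem_Ioi]; positivity⟩

/-- The fractional gradient of a function with finite Gagliardo seminorm exists. -/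
theorem exists_isWeightedGradient (hs0 : 0 < s) (hs1 : s < 1)
    {u : E n → ℝ} (hm : Measurable u) (h1 : Integrable u) (h2 : MemLp u 2)
    (hg : gagliardo s u < ⊤) :
    ∃ G, IsWeightedGradient (fracWeight n s) (fracKernel n) u G ∧ MemLp G 2 ∧
      eLpNorm G 2 volume ^ 2 = ENNReal.ofReal (Cns n s / 2) * gagliardo s u := by
  set e : ℕ → ℝ := fun k => 1 / ((k : ℝ) + 1) with he
  have hepos : ∀ k, 0 < e k := fun k => by positivity
  have het : Tendsto e atTop (𝓝[>] 0) := tendsto_one_div_nhdsGT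
  have hD := memLp_gradDensity hs0 hs1 hm h1 h2 hg
  have hDk := fun k => memLp_truncDensity (n := n) hs0 hs1 (hepos k) h1
  have hTk := fun k => memLp_truncGrad (n := n) hs0 hs1 (hepos k) h1
  have hconv := tendsto_eLpNorm_truncDensity_sub hs0 hs1 hm h1 h2 hg
  have hH : Tendsto (fun k => (hDk k).toLp _) atTop (𝓝 (hD.toLp _)) :=
    (Lp.tendsto_Lp_iff_tendsto_eLpNorm'' _ hDk _ hD).2 (hconv.comp het)
  -- The Fourier-side sequence converges, and the isometry on differences makes the physical-side
  -- sequence Cauchy.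
  have hedist : ∀ k m, edist ((hTk k).toLp _) ((hTk m).toLp _) =
      edist ((hDk k).toLp _) ((hDk m).toLp _) := by
    intro k m
    rw [Lp.edist_toLp_toLp, Lp.edist_toLp_toLp,
      eLpNorm_truncGrad_sub hs0 hs1 (hepos k) (hepos m) h1]
  have hcau : CauchySeq fun k => (hTk k).toLp _ := by
    have h := hH.cauchySeq
    rw [EMetric.cauchySeq_iff] at h ⊢
    simpa only [hedist] using h
  obtain ⟨F, hF⟩ := cauchySeq_tendsto_of_complete hcau
  have hFk : Tendsto (fun k => eLpNorm (truncGrad n s (e k) u - (F : E n → E n)) 2 volume) atTop (𝓝 0) := by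
    have h := (Lp.tendsto_Lp_iff_tendsto_eLpNorm'' _ hTk _ (Lp.memLp F)).1
      (by rwa [Lp.toLp_coeFn])
    exact h
  refine ⟨(F : E n → E n), ⟨Lp.aestronglyMeasurable F, ?_⟩, Lp.memLp F, ?_⟩
  -- To pass from the sequence `e k` to all `ε ↓ 0`, compare level `ε` with level `e k` and let `k →
  -- ∞` at fixed `ε`.
  · refine tendsto_of_tendsto_of_tendsto_of_le_of_le' tendsto_const_nhds hconv
      (Eventually.of_forall fun _ => zero_le) ?_
    filter_upwards [eventually_pos_nhdsGT] with ε hε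
    have hlim : Tendsto (fun k => eLpNorm (truncDensity n s ε u - gradDensity n s u) 2 volume +
        eLpNorm (truncDensity n s (e k) u - gradDensity n s u) 2 volume +
        eLpNorm (truncGrad n s (e k) u - (F : E n → E n)) 2 volume) atTop
        (𝓝 (eLpNorm (truncDensity n s ε u - gradDensity n s u) 2 volume + 0 + 0)) :=
      (tendsto_const_nhds.add (hconv.comp het)).add hFk
    rw [add_zero, add_zero] at hlim
    refine ge_of_tendsto' hlim fun k => ?_
    have hTε := memLp_truncGrad (n := n) hs0 hs1 hε h1
    have hDε := memLp_truncDensity (n := n) hs0 hs1 hε h1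
    calc eLpNorm (truncGrad n s ε u - (F : E n → E n)) 2 volume
        = eLpNorm ((truncGrad n s ε u - truncGrad n s (e k) u) +
            (truncGrad n s (e k) u - (F : E n → E n))) 2 volume := by rw [sub_add_sub_cancel]
      _ ≤ eLpNorm (truncGrad n s ε u - truncGrad n s (e k) u) 2 volume +
            eLpNorm (truncGrad n s (e k) u - (F : E n → E n)) 2 volume :=
          eLpNorm_add_le (hTε.1.sub (hTk k).1) ((hTk k).1.sub (Lp.aestronglyMeasurable F))
            one_le_two
      _ ≤ _ := by
          gcongr
          rw [eLpNorm_truncGrad_sub hs0 hs1 hε (hepos k) h1]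
          calc _ = eLpNorm ((truncDensity n s ε u - gradDensity n s u) -
                (truncDensity n s (e k) u - gradDensity n s u)) 2 volume := by
                rw [sub_sub_sub_cancel_right]
            _ ≤ _ := eLpNorm_sub_le (hDε.1.sub hD.1) ((hDk k).1.sub hD.1) one_le_two
  · rw [← lintegral_enorm_gradDensity_sq hs0 hs1 hm h1 h2]
    congr 1
    have hn1 : Tendsto (fun k => ‖(hTk k).toLp _‖ₑ) atTop (𝓝 ‖F‖ₑ) := hF.enorm
    have hn2 : Tendsto (fun k => ‖(hDk k).toLp _‖ₑ) atTop (𝓝 ‖hD.toLp _‖ₑ) := hH.enorm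
    have heq : ∀ k, ‖(hTk k).toLp _‖ₑ = ‖(hDk k).toLp _‖ₑ := fun k => by
      rw [Lp.enorm_toLp, Lp.enorm_toLp, eLpNorm_truncGrad hs0 hs1 (hepos k) h1]
    simp only [heq] at hn1
    have := tendsto_nhds_unique hn1 hn2
    rwa [Lp.enorm_toLp, Lp.enorm_def] at this

theorem IsWeightedGradient.ae_unique (hs0 : 0 < s) (hs1 : s < 1) {u : E n → ℝ}
    (h1 : Integrable u) {G G' : E n → E n}
    (h : IsWeightedGradient (fracWeight n s) (fracKernel n) u G)
    (h' : IsWeightedGradient (fracWeight n s) (fracKernel n) u G') : G =ᵐ[volume] G' := by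
  have hlim := h'.2.add h.2
  rw [add_zero] at hlim
  have hz : eLpNorm (G - G') 2 volume ≤ 0 := by
    refine ge_of_tendsto hlim ?_
    filter_upwards [eventually_pos_nhdsGT] with ε hε
    have hT := (memLp_truncGrad (n := n) hs0 hs1 hε h1).1
    calc eLpNorm (G - G') 2 volume
        = eLpNorm ((truncGrad n s ε u - G') - (truncGrad n s ε u - G)) 2 volume := by
          rw [sub_sub_sub_cancel_left]
      _ ≤ _ := eLpNorm_sub_le (hT.sub h'.1) (hT.sub h.1) one_le_two
  have hz' := (eLpNorm_eq_zero_iff (h.1.sub h'.1) two_ne_zero).1 (le_zero_iff.1 hz)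
  filter_upwards [hz'] with x hx
  exact sub_eq_zero.1 hx

/-- A function whose fractional gradient exists has finite Gagliardo seminorm. -/
theorem IsWeightedGradient.gagliardo_lt_top (hs0 : 0 < s) (hs1 : s < 1) {u : E n → ℝ}
    (hm : Measurable u) (h1 : Integrable u) (h2 : MemLp u 2) {G : E n → E n}
    (h : IsWeightedGradient (fracWeight n s) (fracKernel n) u G) : gagliardo s u < ⊤ := by
  have hev : ∀ᶠ ε : ℝ in 𝓝[>] 0, eLpNorm (truncGrad n s ε u - G) 2 volume ≤ 1 :=
    h.2.eventually_le_const one_pos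
  have het := tendsto_one_div_nhdsGT
  obtain ⟨ε₀, hle₀, hε₀⟩ := (hev.and eventually_pos_nhdsGT).exists
  -- The definition of a gradient does not put `G` in `L²`, so all small truncations are compared
  -- with one fixed truncation `ε₀`.
  set C : ℝ≥0∞ := 1 + (1 + eLpNorm (truncGrad n s ε₀ u) 2 volume) with hC
  have hT₀ := memLp_truncGrad (n := n) hs0 hs1 hε₀ h1
  have hCt : C < ⊤ := by
    have := hT₀.2
    rw [hC]; finiteness
  have hbound : ∀ᶠ ε : ℝ in 𝓝[>] 0, eLpNorm (truncDensity n s ε u) 2 volume ≤ C := by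
    filter_upwards [hev, eventually_pos_nhdsGT] with ε hle hε
    have hT := memLp_truncGrad (n := n) hs0 hs1 hε h1
    rw [← eLpNorm_truncGrad hs0 hs1 hε h1]
    calc eLpNorm (truncGrad n s ε u) 2 volume
        = eLpNorm ((truncGrad n s ε u - G) -
            ((truncGrad n s ε₀ u - G) - truncGrad n s ε₀ u)) 2 volume := by
          congr 1; abel
      _ ≤ eLpNorm (truncGrad n s ε u - G) 2 volume +
            eLpNorm ((truncGrad n s ε₀ u - G) - truncGrad n s ε₀ u) 2 volume :=
          eLpNorm_sub_le (hT.1.sub h.1) ((hT₀.1.sub h.1).sub hT₀.1) one_le_two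
      _ ≤ eLpNorm (truncGrad n s ε u - G) 2 volume +
            (eLpNorm (truncGrad n s ε₀ u - G) 2 volume + eLpNorm (truncGrad n s ε₀ u) 2 volume) := by
          gcongr
          exact eLpNorm_sub_le (hT₀.1.sub h.1) hT₀.1 one_le_two
      _ ≤ C := by rw [hC]; gcongr
  -- Fatou along `1/(k+1)` carries the uniform bound over to the full density, whose norm is the
  -- seminorm.
  have hfatou : eLpNorm (gradDensity n s u) 2 volume ^ 2 ≤ C ^ 2 := by
    rw [eLpNorm_two_sq]
    calc ∫⁻ ξ, ‖gradDensity n s u ξ‖ₑ ^ 2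
        = ∫⁻ ξ, liminf (fun k : ℕ => ‖truncDensity n s (1 / ((k : ℝ) + 1)) u ξ‖ₑ ^ 2) atTop := by
          refine lintegral_congr fun ξ => ?_
          exact (ENNReal.Tendsto.pow
            ((tendsto_truncDensity hs0 hs1 u ξ).comp het).enorm).liminf_eq.symm
      _ ≤ liminf (fun k : ℕ => ∫⁻ ξ, ‖truncDensity n s (1 / ((k : ℝ) + 1)) u ξ‖ₑ ^ 2) atTop :=
          lintegral_liminf_le fun k => (measurable_truncDensity _ h1).enorm.pow_const 2
      _ ≤ C ^ 2 := by
          refine liminf_le_of_frequently_le' (Eventually.frequently ?_)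
          filter_upwards [het.eventually hbound] with k hk
          rw [← eLpNorm_two_sq]
          gcongr
  rw [lintegral_enorm_gradDensity_sq hs0 hs1 hm h1 h2] at hfatou
  have hlt := hfatou.trans_lt (ENNReal.pow_lt_top hCt)
  by_contra hn
  rw [not_lt, top_le_iff] at hn
  rw [hn, ENNReal.mul_top] at hlt
  · exact hlt.ne rfl
  · have := Cns_pos n hs0 hs1
    simpa using this

/-- The fractional gradient is given by the integral formula where the integral converges. -/
theorem IsWeightedGradient.ae_eq_integral (hs0 : 0 < s) (hs1 : s < 1) {u : E n → ℝ}
    (h1 : Integrable u) {G : E n → E n}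
    (h : IsWeightedGradient (fracWeight n s) (fracKernel n) u G) :
    ∀ᵐ x, Integrable (fun y => (fracWeight n s x y * (u y - u x)) • fracKernel n x y) →
      G x = ∫ y, (fracWeight n s x y * (u y - u x)) • fracKernel n x y := by
  have het := tendsto_one_div_nhdsGT
  have hpos : ∀ k : ℕ, 0 < 1 / ((k : ℝ) + 1) := fun k => by positivity
  -- Convergence in `L²` gives almost everywhere convergence along a subsequence; where the integral
  -- converges absolutely, dominated convergence identifies the limit.
  have hmeas : TendstoInMeasure volume (fun k : ℕ => truncGrad n s (1 / ((k : ℝ) + 1)) u)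
      atTop G :=
    tendstoInMeasure_of_tendsto_eLpNorm two_ne_zero
      (fun k => (memLp_truncGrad hs0 hs1 (hpos k) h1).1) h.1 (h.2.comp het)
  obtain ⟨φ, hφ, hae⟩ := hmeas.exists_seq_tendsto_ae
  filter_upwards [hae] with x hx hint
  refine tendsto_nhds_unique hx ?_
  have key : Tendsto (fun ε => truncGrad n s ε u x) (𝓝[>] 0)
      (𝓝 (∫ y, (fracWeight n s x y * (u y - u x)) • fracKernel n x y)) := by
    have hms : ∀ ε : ℝ, MeasurableSet {y : E n | ε < ‖y - x‖} := fun ε =>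
      measurableSet_lt measurable_const (by fun_prop)
    simp only [truncatedGradient, ← integral_indicator (hms _)]
    refine tendsto_integral_filter_of_dominated_convergence
      (fun y => ‖(fracWeight n s x y * (u y - u x)) • fracKernel n x y‖) ?_ ?_ hint.norm ?_
    · exact Eventually.of_forall fun ε => hint.aestronglyMeasurable.indicator (hms ε)
    · exact Eventually.of_forall fun ε => ae_of_all _ fun z => norm_indicator_le_norm_self _ _
    · refine ae_of_all _ fun y => tendsto_const_nhds.congr' ?_
      rcases eq_or_ne y x with rfl | hy
      · exact Eventually.of_forall fun ε => by simp [indicator_apply]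
      · have hy : 0 < ‖y - x‖ := norm_pos_iff.2 (sub_ne_zero.2 hy)
        filter_upwards [nhdsWithin_le_nhds (Iio_mem_nhds hy)] with ε (hε : ε < ‖y - x‖)
        rw [indicator_of_mem (show y ∈ {y : E n | ε < ‖y - x‖} from hε)]
  exact key.comp (het.comp hφ.tendsto_atTop)

theorem isWeightedGradient_weightedGradient {n : ℕ} {ω : E n → E n → ℝ} {α : E n → E n → E n}
    {u : E n → ℝ} (h : ∃ G, IsWeightedGradient ω α u G) :
    IsWeightedGradient ω α u (weightedGradient ω α u) := by
  rw [weightedGradient, dif_pos h]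
  exact h.choose_spec

/-- Truncated gradients depend linearly on the function and only on its class, and this survives in
the limit. -/
theorem IsWeightedGradient.add_const_smul (hs0 : 0 < s) (hs1 : s < 1) {u v w : E n → ℝ}
    (hu : Integrable u) (hv : Integrable v) (hw : Integrable w) {c : ℝ}
    (huvw : w =ᵐ[volume] fun x => u x + c * v x)
    {G H : E n → E n} (hG : IsWeightedGradient (fracWeight n s) (fracKernel n) u G)
    (hH : IsWeightedGradient (fracWeight n s) (fracKernel n) v H) :
    IsWeightedGradient (fracWeight n s) (fracKernel n) w (G + c • H) := by
  refine ⟨hG.1.add (hH.1.const_smul c), ?_⟩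
  have hlim := hG.2.add (ENNReal.Tendsto.const_mul (a := ‖c‖ₑ) hH.2 (Or.inr (by simp)))
  rw [mul_zero, add_zero] at hlim
  refine tendsto_of_tendsto_of_tendsto_of_le_of_le' tendsto_const_nhds hlim
    (Eventually.of_forall fun _ => zero_le) ?_
  filter_upwards [eventually_pos_nhdsGT] with ε hε
  have hTu := (memLp_truncGrad (n := n) hs0 hs1 hε hu).1
  have hTv := (memLp_truncGrad (n := n) hs0 hs1 hε hv).1
  have hlin : ∀ x, truncGrad n s ε w x = truncGrad n s ε u x + c • truncGrad n s ε v x := by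
    intro x
    have hk := (measurable_truncKernel (n := n) (s := s) ε).aestronglyMeasurable (μ := volume)
    have hiu := integrable_smul_kernel hk (norm_truncKernel_le hs0 hε) hu x
    have hiv : Integrable fun y => c • v y • truncKernel n s ε (y - x) :=
      (integrable_smul_kernel hk (norm_truncKernel_le hs0 hε) hv x).smul c
    rw [truncGrad_eq hs0 hs1 hε hw, truncGrad_eq hs0 hs1 hε hu, truncGrad_eq hs0 hs1 hε hv,
      ← integral_smul, ← integral_add hiu hiv]
    refine integral_congr_ae ?_
    filter_upwards [huvw] with y hy
    rw [hy, add_smul, mul_smul]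
  calc _ = eLpNorm ((truncGrad n s ε u - G) + c • (truncGrad n s ε v - H)) 2 volume := by
        congr 1
        ext1 x
        simp only [hlin, Pi.add_apply, Pi.sub_apply, Pi.smul_apply, smul_sub]
        abel
    _ ≤ _ := eLpNorm_add_le (hTu.sub hG.1) ((hTv.sub hH.1).const_smul c) one_le_two
    _ = _ := by rw [eLpNorm_const_smul]; rfl

end

/-! ### The Poincaré inequality and the gradient as a linear map with closed range. -/

section

open Set Real

variable {n : ℕ} {s : ℝ} {Ω : Set (E n)}

theorem measurable_coe_L2 (u : L2 n) : Measurable (u : E n → ℝ) :=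
  (Lp.stronglyMeasurable u).measurable

/-- On a ball containing `Ω`, which has finite measure, `L²` embeds in `L¹`. This makes the Fourier
integral available. -/
theorem integrable_of_ae_eq_zero (hΩb : Bornology.IsBounded Ω) {u : L2 n}
    (hu : ∀ᵐ x, x ∉ Ω → u x = 0) : Integrable (u : E n → ℝ) := by
  obtain ⟨R, hR⟩ := hΩb.subset_closedBall 0
  have hfin : IsFiniteMeasure ((volume : Measure (E n)).restrict (Metric.closedBall 0 R)) :=
    ⟨by rw [Measure.restrict_apply_univ]; exact measure_closedBall_lt_top⟩
  have h1 : IntegrableOn (u : E n → ℝ) (Metric.closedBall 0 R) :=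
    ((Lp.memLp u).restrict _).integrable one_le_two
  refine h1.integrable_of_ae_notMem_eq_zero ?_
  filter_upwards [hu] with x hx hxB
  exact hx fun h => hxB (hR h)

/-- Fatou's lemma, once in each variable. -/
theorem gagliardo_lowerSemicontinuous {u : E n → ℝ} {f : ℕ → E n → ℝ}
    (hf : ∀ k, Measurable (f k)) (h : ∀ᵐ x, Tendsto (fun k => f k x) atTop (𝓝 (u x))) :
    gagliardo s u ≤ liminf (fun k => gagliardo s (f k)) atTop := by
  have hm : ∀ k, Measurable (Function.uncurry fun x y : E n =>
      ENNReal.ofReal (|f k x - f k y| ^ 2 / ‖x - y‖ ^ ((n : ℝ) + 2 * s))) := by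
    intro k
    have := hf k
    simp only [Function.uncurry_def, sq_abs]
    fun_prop
  calc gagliardo s u
      = ∫⁻ x, ∫⁻ y, liminf (fun k =>
          ENNReal.ofReal (|f k x - f k y| ^ 2 / ‖x - y‖ ^ ((n : ℝ) + 2 * s))) atTop := by
        refine lintegral_congr_ae ?_
        filter_upwards [h] with x hx
        refine lintegral_congr_ae ?_
        filter_upwards [h] with y hy
        exact (ENNReal.tendsto_ofReal
          (((hx.sub hy).abs.pow 2).div_const _)).liminf_eq.symm
    _ ≤ ∫⁻ x, liminf (fun k => ∫⁻ y,
          ENNReal.ofReal (|f k x - f k y| ^ 2 / ‖x - y‖ ^ ((n : ℝ) + 2 * s))) atTop :=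
        lintegral_mono fun x => lintegral_liminf_le fun k => (hm k).comp measurable_prodMk_left
    _ ≤ _ := lintegral_liminf_le fun k => Measurable.lintegral_prod_right (hm k)

/-- The fractional Poincaré inequality. -/
theorem exists_norm_sq_le_gagliardo [NeZero n] (hs0 : 0 < s) (hΩb : Bornology.IsBounded Ω) :
    ∃ c : ℝ, 0 < c ∧ ∀ u ∈ HsOmega s Ω, ‖u‖ ^ 2 ≤ c * (gagliardo s u).toReal := by
  obtain ⟨R, hR0, hR⟩ := hΩb.subset_ball_lt 0 0
  -- The unit ball `S` around a point at distance `R + 1` misses `Ω`. There `u = 0`, so for `x ∈ Ω`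
  -- the difference quotient over `S` is at least `|u x|² / (2R+2)^q`; integrating over `S` yields
  -- the constant `m`.
  set p : E n := EuclideanSpace.single 0 (R + 1) with hp
  have hpn : ‖p‖ = R + 1 := by
    rw [hp, EuclideanSpace.single, PiLp.norm_single, Real.norm_of_nonneg (by linarith)]
  set S := Metric.ball p 1 with hS
  have hSΩ : ∀ y ∈ S, y ∉ Ω := by
    intro y hy hyΩ
    have h1 : ‖y‖ < R := by simpa using hR hyΩ
    have h2 : ‖y - p‖ < 1 := by simpa [hS, dist_eq_norm] using hy
    have h3 := norm_sub_norm_le p y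
    rw [norm_sub_rev] at h3
    linarith
  have hdist : ∀ x ∈ Ω, ∀ y ∈ S, ‖x - y‖ ≤ 2 * R + 2 := by
    intro x hx y hy
    have h1 : ‖x‖ < R := by simpa using hR hx
    have h2 : ‖y - p‖ < 1 := by simpa [hS, dist_eq_norm] using hy
    have h3 := norm_sub_norm_le y p
    have h4 := norm_sub_le x y
    linarith
  set q : ℝ := (n : ℝ) + 2 * s with hq
  have hq0 : 0 ≤ q := by positivity
  set m : ℝ := volume.real S / (2 * R + 2) ^ q with hm
  have hSpos : 0 < volume.real S :=
    ENNReal.toReal_pos (Metric.measure_ball_pos volume p one_pos).ne' measure_ball_lt_top.ne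
  have hmpos : 0 < m := by positivity
  refine ⟨m⁻¹, inv_pos.2 hmpos, fun u hu => ?_⟩
  have key : ENNReal.ofReal m * ∫⁻ x, ‖u x‖ₑ ^ 2 ≤ gagliardo s u := by
    rw [← lintegral_const_mul' _ _ ENNReal.ofReal_ne_top]
    refine lintegral_mono_ae ?_
    filter_upwards [hu.2] with x hx
    by_cases hxΩ : x ∈ Ω
    · calc ENNReal.ofReal m * ‖u x‖ₑ ^ 2
          = ∫⁻ y in S, ENNReal.ofReal (|u x| ^ 2 / (2 * R + 2) ^ q) := by
            rw [lintegral_const, Measure.restrict_apply_univ, hm, ← ofReal_norm,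
              ← ENNReal.ofReal_pow (norm_nonneg _), ← ENNReal.ofReal_mul (by positivity),
              ← ENNReal.ofReal_toReal (measure_ball_lt_top (x := p) (r := 1) (μ := volume)).ne,
              ← ENNReal.ofReal_mul (by positivity), norm_eq_abs]
            congr 1
            rw [measureReal_def]
            ring
        _ ≤ ∫⁻ y in S, ENNReal.ofReal (|u x - u y| ^ 2 / ‖x - y‖ ^ q) := by
            refine lintegral_mono_ae ?_
            filter_upwards [ae_restrict_of_ae hu.2, ae_restrict_mem Metric.isOpen_ball.measurableSet]
              with y hy hyS
            rw [hy (hSΩ y hyS), sub_zero]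
            refine ENNReal.ofReal_le_ofReal ?_
            have hxy : 0 < ‖x - y‖ := norm_pos_iff.2 (sub_ne_zero.2 fun h =>
              hSΩ y hyS (h ▸ hxΩ))
            have := hdist x hxΩ y hyS
            gcongr
        _ ≤ _ := setLIntegral_le_lintegral _ _
    · simp [hx hxΩ]
  have hnorm : ∫⁻ x, ‖u x‖ₑ ^ 2 = ENNReal.ofReal (‖u‖ ^ 2) := by
    rw [← eLpNorm_two_sq, ← Lp.enorm_def, ← ofReal_norm, ENNReal.ofReal_pow (norm_nonneg _)]
  rw [hnorm, ← ENNReal.ofReal_mul hmpos.le] at key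
  have h2 := ENNReal.toReal_mono hu.1.ne key
  rw [ENNReal.toReal_ofReal (by positivity)] at h2
  rwa [inv_mul_eq_div, le_div_iff₀' hmpos]

section Gradient

variable [NeZero n]

/-- The fractional gradient of a function. -/
abbrev fracGrad (n : ℕ) [NeZero n] (s : ℝ) (u : E n → ℝ) : E n → E n :=
  weightedGradient (fracWeight n s) (fracKernel n) u

theorem isWeightedGradient_fracGrad (hs0 : 0 < s) (hs1 : s < 1) (hΩb : Bornology.IsBounded Ω)
    {u : L2 n} (hu : u ∈ HsOmega s Ω) :
    IsWeightedGradient (fracWeight n s) (fracKernel n) u (fracGrad n s u) := by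
  obtain ⟨G, hG, -⟩ := exists_isWeightedGradient hs0 hs1 (measurable_coe_L2 u)
    (integrable_of_ae_eq_zero hΩb hu.2) (Lp.memLp u) hu.1
  exact isWeightedGradient_weightedGradient ⟨G, hG⟩

theorem memLp_fracGrad (hs0 : 0 < s) (hs1 : s < 1) (hΩb : Bornology.IsBounded Ω)
    {u : L2 n} (hu : u ∈ HsOmega s Ω) :
    MemLp (fracGrad n s u) 2 ∧
      eLpNorm (fracGrad n s u) 2 volume ^ 2 = ENNReal.ofReal (Cns n s / 2) * gagliardo s u := by
  have hi := integrable_of_ae_eq_zero hΩb hu.2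
  obtain ⟨G, hG, hG2, hGn⟩ := exists_isWeightedGradient hs0 hs1 (measurable_coe_L2 u) hi
    (Lp.memLp u) hu.1
  have hae := hG.ae_unique hs0 hs1 hi (isWeightedGradient_fracGrad hs0 hs1 hΩb hu)
  exact ⟨hG2.ae_eq hae, by rw [← hGn, eLpNorm_congr_ae hae]⟩

/-- The gradient is a chosen representative, so linearity holds only almost everywhere and comes
from uniqueness. -/
theorem fracGrad_add_smul (hs0 : 0 < s) (hs1 : s < 1) (hΩb : Bornology.IsBounded Ω)
    {u v : L2 n} (hu : u ∈ HsOmega s Ω) (hv : v ∈ HsOmega s Ω) (c : ℝ) :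
    fracGrad n s ((u + c • v : L2 n) : E n → ℝ) =ᵐ[volume]
      fracGrad n s u + c • fracGrad n s v := by
  have hw : u + c • v ∈ HsOmega s Ω := add_mem hu (Submodule.smul_mem _ c hv)
  have hi := integrable_of_ae_eq_zero hΩb hw.2
  refine (isWeightedGradient_fracGrad hs0 hs1 hΩb hw).ae_unique hs0 hs1 hi
    (IsWeightedGradient.add_const_smul hs0 hs1 (integrable_of_ae_eq_zero hΩb hu.2)
      (integrable_of_ae_eq_zero hΩb hv.2) hi ?_ (isWeightedGradient_fracGrad hs0 hs1 hΩb hu)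
      (isWeightedGradient_fracGrad hs0 hs1 hΩb hv))
  filter_upwards [Lp.coeFn_add u (c • v), Lp.coeFn_smul c v] with x h1 h2
  rw [h1, Pi.add_apply, h2, Pi.smul_apply, smul_eq_mul]

/-- The fractional gradient as a linear map from `H^s_Ω` to `L²`. -/
def gradLp (hs0 : 0 < s) (hs1 : s < 1) (hΩb : Bornology.IsBounded Ω) :
    HsOmega s Ω →ₗ[ℝ] Lp (E n) 2 (volume : Measure (E n)) where
  toFun u := (memLp_fracGrad hs0 hs1 hΩb u.2).1.toLp _
  map_add' u v := by
    rw [← MemLp.toLp_add, MemLp.toLp_eq_toLp_iff]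
    have h := fracGrad_add_smul hs0 hs1 hΩb u.2 v.2 1
    rwa [one_smul, one_smul] at h
  map_smul' c u := by
    rw [RingHom.id_apply, ← MemLp.toLp_const_smul, MemLp.toLp_eq_toLp_iff]
    have h := fracGrad_add_smul hs0 hs1 hΩb (zero_mem _) u.2 c
    -- The gradient of `0` equals twice itself almost everywhere, hence vanishes.
    have h0 := fracGrad_add_smul hs0 hs1 hΩb (zero_mem _) (zero_mem (HsOmega s Ω)) 1
    rw [zero_add] at h
    rw [smul_zero, zero_add] at h0
    filter_upwards [h, h0] with x hx hx0
    have hz : fracGrad n s ((0 : L2 n) : E n → ℝ) x = 0 := by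
      simpa using hx0
    rw [Submodule.coe_smul, hx, Pi.add_apply, hz, zero_add]

theorem coeFn_gradLp (hs0 : 0 < s) (hs1 : s < 1) (hΩb : Bornology.IsBounded Ω)
    (u : HsOmega s Ω) : gradLp hs0 hs1 hΩb u =ᵐ[volume] fracGrad n s (u : L2 n) :=
  MemLp.coeFn_toLp (memLp_fracGrad hs0 hs1 hΩb u.2).1

theorem norm_gradLp_sq (hs0 : 0 < s) (hs1 : s < 1) (hΩb : Bornology.IsBounded Ω)
    (u : HsOmega s Ω) :
    ‖gradLp hs0 hs1 hΩb u‖ ^ 2 = Cns n s / 2 * (gagliardo s (u : L2 n)).toReal := by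
  have hC := Cns_pos n hs0 hs1
  have h := congrArg ENNReal.toReal (memLp_fracGrad hs0 hs1 hΩb u.2).2
  rw [ENNReal.toReal_mul, ENNReal.toReal_ofReal (by positivity), ENNReal.toReal_pow] at h
  rw [← h]
  congr 1
  exact Lp.norm_toLp _ (memLp_fracGrad hs0 hs1 hΩb u.2).1

/-- Completeness of `H^s_Ω` in disguise. If the gradients converge, Poincaré makes the functions
converge in `L²`; Fatou for the seminorm then shows that the limit is in `H^s_Ω` and that its
gradient is the limit of the gradients. -/
theorem isClosed_range_gradLp (hs0 : 0 < s) (hs1 : s < 1) (hΩb : Bornology.IsBounded Ω) :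
    IsClosed (LinearMap.range (gradLp hs0 hs1 hΩb) :
      Set (Lp (E n) 2 (volume : Measure (E n)))) := by
  have hC := Cns_pos n hs0 hs1
  obtain ⟨c, hc, hP⟩ := exists_norm_sq_le_gagliardo (n := n) (Ω := Ω) hs0 hΩb
  refine IsSeqClosed.isClosed fun F G hF hFG => ?_
  choose u hu using hF
  have hcau : CauchySeq fun k => gradLp hs0 hs1 hΩb (u k) := by
    simpa only [hu] using hFG.cauchySeq
  have hnorm : ∀ v : HsOmega s Ω, ‖(v : L2 n)‖ ^ 2 ≤
      c * (2 / Cns n s) * ‖gradLp hs0 hs1 hΩb v‖ ^ 2 := fun v => by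
    rw [norm_gradLp_sq]
    refine (hP v v.2).trans_eq ?_
    field_simp
  have hcauL : CauchySeq fun k => (u k : L2 n) := by
    rw [Metric.cauchySeq_iff] at hcau ⊢
    intro ε hε
    have hA : 0 < c * (2 / Cns n s) := by positivity
    obtain ⟨N, hN⟩ := hcau (ε / √(c * (2 / Cns n s))) (by positivity)
    refine ⟨N, fun k hk m hm => ?_⟩
    have h1 := hN k hk m hm
    rw [dist_eq_norm] at h1 ⊢
    rw [← map_sub] at h1
    have h2 := hnorm (u k - u m)
    rw [← Submodule.coe_sub]
    refine lt_of_pow_lt_pow_left₀ 2 hε.le (h2.trans_lt ?_)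
    calc c * (2 / Cns n s) * ‖gradLp hs0 hs1 hΩb (u k - u m)‖ ^ 2
        < c * (2 / Cns n s) * (ε / √(c * (2 / Cns n s))) ^ 2 := by gcongr
      _ = ε ^ 2 := by rw [div_pow, Real.sq_sqrt hA.le]; field_simp
  obtain ⟨w, hw⟩ := cauchySeq_tendsto_of_complete hcauL
  obtain ⟨φ, hφ, hae⟩ := (tendstoInMeasure_of_tendsto_Lp hw).exists_seq_tendsto_ae
  -- For fixed `m`, lower semicontinuity along the almost everywhere convergent subsequence carries
  -- the Cauchy estimate to the limit `w`.
  have hlsc : ∀ ε > 0, ∃ N, ∀ m ≥ N,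
      gagliardo s ((w - u m : L2 n) : E n → ℝ) ≤ ENNReal.ofReal (2 / Cns n s * ε ^ 2) := by
    intro ε hε
    obtain ⟨N, hN⟩ := Metric.cauchySeq_iff.1 hcau ε hε
    refine ⟨N, fun m hm => ?_⟩
    have hconv : ∀ᵐ x, Tendsto (fun k => ((u (φ k) - u m : L2 n) : E n → ℝ) x) atTop
        (𝓝 (((w - u m : L2 n) : E n → ℝ) x)) := by
      have hsub : ∀ᵐ x, ∀ k, ((u (φ k) - u m : L2 n) : E n → ℝ) x =
          (u (φ k) : L2 n) x - (u m : L2 n) x :=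
        ae_all_iff.2 fun k => Lp.coeFn_sub _ _
      filter_upwards [hae, hsub, Lp.coeFn_sub w (u m : L2 n)] with x hx h1 h2
      simp only [h1, h2, Pi.sub_apply]
      exact hx.sub_const _
    refine (gagliardo_lowerSemicontinuous (fun k => measurable_coe_L2 _) hconv).trans ?_
    refine liminf_le_of_frequently_le' (Eventually.frequently ?_)
    filter_upwards [eventually_ge_atTop N] with k hk
    have h1 := hN (φ k) (hk.trans (hφ.id_le k)) m hm
    rw [dist_eq_norm, ← map_sub] at h1
    have h2 := norm_gradLp_sq hs0 hs1 hΩb (u (φ k) - u m)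
    have h3 : (gagliardo s ((u (φ k) - u m : HsOmega s Ω) : L2 n)).toReal ≤
        2 / Cns n s * ε ^ 2 := by
      have h4 : ‖gradLp hs0 hs1 hΩb (u (φ k) - u m)‖ ^ 2 ≤ ε ^ 2 := by gcongr
      rw [h2] at h4
      calc _ = 2 / Cns n s * (Cns n s / 2 *
            (gagliardo s ((u (φ k) - u m : HsOmega s Ω) : L2 n)).toReal) := by field_simp
        _ ≤ _ := by gcongr
    exact (ENNReal.le_ofReal_iff_toReal_le (u (φ k) - u m).2.1.ne (by positivity)).2 h3
  have hw0 : ∀ᵐ x, x ∉ Ω → w x = 0 := by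
    have hall : ∀ᵐ x, ∀ k, x ∉ Ω → (u (φ k) : L2 n) x = 0 :=
      ae_all_iff.2 fun k => (u (φ k)).2.2
    filter_upwards [hae, hall] with x hx h hxΩ
    refine tendsto_nhds_unique hx ?_
    simp only [h _ hxΩ]
    exact tendsto_const_nhds
  have hwmem : w ∈ HsOmega s Ω := by
    obtain ⟨N, hN⟩ := hlsc 1 one_pos
    have hd : w - u N ∈ HsOmega s Ω := by
      refine ⟨(hN N le_rfl).trans_lt ENNReal.ofReal_lt_top, ?_⟩
      filter_upwards [Lp.coeFn_sub w (u N : L2 n), hw0, (u N).2.2] with x h1 h2 h3 hx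
      rw [h1, Pi.sub_apply, h2 hx, h3 hx, sub_zero]
    have := add_mem hd (u N).2
    rwa [sub_add_cancel] at this
  refine ⟨⟨w, hwmem⟩, tendsto_nhds_unique ?_ hFG⟩
  refine Metric.tendsto_atTop.2 fun ε hε => ?_
  obtain ⟨N, hN⟩ := hlsc (ε / 2) (by positivity)
  refine ⟨N, fun m hm => ?_⟩
  have h1 := hN m hm
  have h2 := norm_gradLp_sq hs0 hs1 hΩb (⟨w, hwmem⟩ - u m)
  have h3 := ENNReal.toReal_mono ENNReal.ofReal_ne_top h1
  rw [ENNReal.toReal_ofReal (by positivity)] at h3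
  rw [← hu, dist_comm, dist_eq_norm, ← map_sub]
  refine lt_of_pow_lt_pow_left₀ 2 hε.le ?_
  rw [h2]
  calc Cns n s / 2 * (gagliardo s ((w - u m : L2 n) : E n → ℝ)).toReal
      ≤ Cns n s / 2 * (2 / Cns n s * (ε / 2) ^ 2) := by gcongr
    _ = (ε / 2) ^ 2 := by field_simp
    _ < ε ^ 2 := by gcongr; linarith

end Gradient

end

/-! ### Cauchy–Schwarz and Lax–Milgram. -/

section

open Set Real

/-- Cauchy–Schwarz for a semidefinite form, from the discriminant of `t ↦ b (v + t • w) (v + t •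
w)`. It upgrades an upper bound on the diagonal to all pairs with the same constant, both for `A x`
and for the integrated form. -/
theorem abs_bilin_le {V : Type*} [NormedAddCommGroup V] [Module ℝ V] (b : V →ₗ[ℝ] V →ₗ[ℝ] ℝ)
    (hsymm : ∀ v w, b v w = b w v) (hpos : ∀ v, 0 ≤ b v v) {C : ℝ} (hC : 0 ≤ C)
    (hle : ∀ v, b v v ≤ C * ‖v‖ ^ 2) (v w : V) : |b v w| ≤ C * ‖v‖ * ‖w‖ := by
  have h : discrim (b w w) (2 * b v w) (b v v) ≤ 0 := by
    refine discrim_le_zero fun t => ?_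
    have := hpos (v + t • w)
    simp only [map_add, map_smul, LinearMap.add_apply, LinearMap.smul_apply, smul_eq_mul,
      hsymm w v] at this
    linarith
  rw [discrim] at h
  refine abs_le_of_sq_le_sq ?_ (by positivity)
  calc b v w ^ 2 ≤ b w w * b v v := by linarith
    _ ≤ (C * ‖w‖ ^ 2) * (C * ‖v‖ ^ 2) :=
      mul_le_mul (hle w) (hle v) (hpos v) (by positivity)
    _ = _ := by ring

/-- The Lax–Milgram theorem for a form that is pulled back along an injective linear map with
closed range. -/
theorem existsUnique_of_coercive {V H : Type*} [AddCommGroup V] [Module ℝ V]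
    [NormedAddCommGroup H] [InnerProductSpace ℝ H] [CompleteSpace H] (T : V →ₗ[ℝ] H)
    (hT : Function.Injective T) (hcl : IsClosed (LinearMap.range T : Set H))
    (a : H →L[ℝ] H →L[ℝ] ℝ) {c : ℝ} (hc : 0 < c) (ha : ∀ v, c * ‖v‖ * ‖v‖ ≤ a v v)
    (F : V →ₗ[ℝ] ℝ) {M : ℝ} (hF : ∀ v, |F v| ≤ M * ‖T v‖) :
    ∃ u, (∀ v, a (T u) (T v) = F v) ∧ ∀ u', (∀ v, a (T u') (T v) = F v) → u' = u := by
  set W := LinearMap.range T with hW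
  have hcomp : CompleteSpace W := hcl.completeSpace_coe
  set e : V ≃ₗ[ℝ] W := LinearEquiv.ofInjective T hT with he
  have heT : ∀ v, ((e v : W) : H) = T v := fun v => rfl
  -- The space `V` carries no norm; its functional is moved to the range of `T`, complete because
  -- closed, where `hF` is continuity.
  set Φ : W →L[ℝ] ℝ := (F ∘ₗ (e.symm : W →ₗ[ℝ] V)).mkContinuous M (fun w => by
    have h := hF (e.symm w)
    rw [← heT, e.apply_symm_apply] at h
    exact h) with hΦ
  set B : W →L[ℝ] W →L[ℝ] ℝ := a.bilinearComp W.subtypeL W.subtypeL with hB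
  have hBa : ∀ v w : W, B v w = a v w := fun v w => rfl
  have hcoer : IsCoercive B := ⟨c, hc, fun w => ha w⟩
  set w := hcoer.continuousLinearEquivOfBilin.symm ((InnerProductSpace.toDual ℝ W).symm Φ) with hw
  have hsol : ∀ v : W, B w v = Φ v := by
    intro v
    rw [← hcoer.continuousLinearEquivOfBilin_apply, hw, ContinuousLinearEquiv.apply_symm_apply,
      InnerProductSpace.toDual_symm_apply]
  have hu : ∀ v, a (T (e.symm w)) (T v) = F v := by
    intro v
    have h := hsol (e v)
    rw [hBa, heT] at h
    rw [← heT, e.apply_symm_apply, h]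
    exact congrArg F (e.symm_apply_apply v)
  refine ⟨e.symm w, hu, fun u' hu' => ?_⟩
  -- Uniqueness: the difference of two solutions tests to zero against itself, so coercivity kills
  -- its image and injectivity the difference.
  have hz : ∀ v, a (T (u' - e.symm w)) (T v) = 0 := fun v => by
    rw [map_sub, map_sub, sub_apply, hu, hu', sub_self]
  have h0 := ha (T (u' - e.symm w))
  rw [hz, mul_assoc] at h0
  have h1 : ‖T (u' - e.symm w)‖ * ‖T (u' - e.symm w)‖ ≤ 0 := by
    by_contra hn
    exact absurd h0 (not_le.2 (mul_pos hc (not_le.1 hn)))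
  have h2 : T (u' - e.symm w) = 0 := by
    rw [← norm_eq_zero]
    nlinarith [norm_nonneg (T (u' - e.symm w))]
  exact sub_eq_zero.1 (hT (h2.trans (map_zero T).symm))

/-! ### The quadratic form of the diffusion tensor on `L²` vector fields. -/

section Tensor

variable {n : ℕ} {A : E n → Matrix (Fin n) (Fin n) ℝ} {lmin lmax : ℝ}

theorem IsDiffusionTensor.inner_symm (hA : IsDiffusionTensor A lmin lmax) (x v w : E n) :
    inner ℝ v ((A x).toEuclideanLin w) = inner ℝ w ((A x).toEuclideanLin v) := by
  have h : ((A x).toEuclideanLin).IsSymmetric := by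
    rw [Matrix.isSymmetric_toEuclideanLin_iff, Matrix.IsHermitian,
      Matrix.conjTranspose_eq_transpose_of_trivial]
    exact hA.symm x
  rw [← h, real_inner_comm]

theorem IsDiffusionTensor.lmax_pos (hA : IsDiffusionTensor A lmin lmax) : 0 < lmax :=
  hA.pos.trans_le hA.le

theorem IsDiffusionTensor.abs_inner_le (hA : IsDiffusionTensor A lmin lmax) (x v w : E n) :
    |inner ℝ v ((A x).toEuclideanLin w)| ≤ lmax * ‖v‖ * ‖w‖ :=
  abs_bilin_le ((innerₗ (E n)).compl₂ (A x).toEuclideanLin) (hA.inner_symm x)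
    (fun v => (mul_nonneg hA.pos.le (sq_nonneg ‖v‖)).trans (hA.lower x v)) hA.lmax_pos.le
    (hA.upper x) v w

theorem IsDiffusionTensor.aestronglyMeasurable_inner (hA : IsDiffusionTensor A lmin lmax)
    {G H : E n → E n} (hG : AEStronglyMeasurable G) (hH : AEStronglyMeasurable H) :
    AEStronglyMeasurable fun x => inner ℝ (G x) ((A x).toEuclideanLin (H x)) := by
  have hGi : ∀ i, AEMeasurable fun x => G x i := fun i =>
    (EuclideanSpace.proj (𝕜 := ℝ) i).continuous.measurable.comp_aemeasurable hG.aemeasurable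
  have hHi : ∀ i, AEMeasurable fun x => H x i := fun i =>
    (EuclideanSpace.proj (𝕜 := ℝ) i).continuous.measurable.comp_aemeasurable hH.aemeasurable
  have he : (fun x => inner ℝ (G x) ((A x).toEuclideanLin (H x))) =
      fun x => ∑ i, (∑ j, A x i j * H x j) * G x i := by
    ext x
    simp [PiLp.inner_apply, Matrix.toLpLin_apply, Matrix.mulVec, dotProduct]
  rw [he]
  refine AEMeasurable.aestronglyMeasurable ?_
  exact Finset.aemeasurable_fun_sum _ fun i _ => (Finset.aemeasurable_fun_sum _ fun j _ =>
    (hA.measurable i j).mul (hHi j)).mul (hGi i)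

theorem IsDiffusionTensor.integrable_inner (hA : IsDiffusionTensor A lmin lmax)
    {G H : E n → E n} (hG : MemLp G 2) (hH : MemLp H 2) :
    Integrable fun x => inner ℝ (G x) ((A x).toEuclideanLin (H x)) := by
  refine ((hG.norm.integrable_mul hH.norm).const_mul lmax).mono'
    (hA.aestronglyMeasurable_inner hG.1 hH.1) (ae_of_all _ fun x => ?_)
  refine (hA.abs_inner_le x _ _).trans_eq ?_
  rw [Pi.mul_apply, mul_assoc]

theorem integral_norm_sq_Lp (G : Lp (E n) 2 (volume : Measure (E n))) :
    ∫ x, ‖G x‖ ^ 2 = ‖G‖ ^ 2 := by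
  rw [← real_inner_self_eq_norm_sq, L2.inner_def]
  simp only [real_inner_self_eq_norm_sq]

theorem integrable_norm_sq_Lp (G : Lp (E n) 2 (volume : Measure (E n))) :
    Integrable fun x => ‖G x‖ ^ 2 :=
  (memLp_two_iff_integrable_sq_norm (Lp.aestronglyMeasurable G)).1 (Lp.memLp G)

/-- The form `∫ G · A H` on `L²`, as a bilinear map. -/
def IsDiffusionTensor.bilin (hA : IsDiffusionTensor A lmin lmax) :
    Lp (E n) 2 (volume : Measure (E n)) →ₗ[ℝ] Lp (E n) 2 (volume : Measure (E n)) →ₗ[ℝ] ℝ :=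
  LinearMap.mk₂ ℝ (fun G H => ∫ x, inner ℝ (G x) ((A x).toEuclideanLin (H x)))
    (fun G G' H => by
      rw [← integral_add (hA.integrable_inner (Lp.memLp G) (Lp.memLp H))
        (hA.integrable_inner (Lp.memLp G') (Lp.memLp H))]
      refine integral_congr_ae ?_
      filter_upwards [Lp.coeFn_add G G'] with x hx
      rw [hx, Pi.add_apply, inner_add_left])
    (fun c G H => by
      rw [smul_eq_mul, ← integral_const_mul]
      refine integral_congr_ae ?_
      filter_upwards [Lp.coeFn_smul c G] with x hx
      rw [hx, Pi.smul_apply, real_inner_smul_left])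
    (fun G H H' => by
      rw [← integral_add (hA.integrable_inner (Lp.memLp G) (Lp.memLp H))
        (hA.integrable_inner (Lp.memLp G) (Lp.memLp H'))]
      refine integral_congr_ae ?_
      filter_upwards [Lp.coeFn_add H H'] with x hx
      rw [hx, Pi.add_apply, map_add, inner_add_right])
    (fun c G H => by
      rw [smul_eq_mul, ← integral_const_mul]
      refine integral_congr_ae ?_
      filter_upwards [Lp.coeFn_smul c H] with x hx
      rw [hx, Pi.smul_apply, map_smul, real_inner_smul_right])

theorem IsDiffusionTensor.bilin_apply (hA : IsDiffusionTensor A lmin lmax)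
    (G H : Lp (E n) 2 (volume : Measure (E n))) :
    hA.bilin G H = ∫ x, inner ℝ (G x) ((A x).toEuclideanLin (H x)) := rfl

theorem IsDiffusionTensor.le_bilin_self (hA : IsDiffusionTensor A lmin lmax)
    (G : Lp (E n) 2 (volume : Measure (E n))) : lmin * ‖G‖ ^ 2 ≤ hA.bilin G G := by
  rw [hA.bilin_apply, ← integral_norm_sq_Lp, ← integral_const_mul]
  exact integral_mono ((integrable_norm_sq_Lp G).const_mul _)
    (hA.integrable_inner (Lp.memLp G) (Lp.memLp G)) fun x => hA.lower x _

theorem IsDiffusionTensor.bilin_self_le (hA : IsDiffusionTensor A lmin lmax)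
    (G : Lp (E n) 2 (volume : Measure (E n))) : hA.bilin G G ≤ lmax * ‖G‖ ^ 2 := by
  rw [hA.bilin_apply, ← integral_norm_sq_Lp, ← integral_const_mul]
  exact integral_mono (hA.integrable_inner (Lp.memLp G) (Lp.memLp G))
    ((integrable_norm_sq_Lp G).const_mul _) fun x => hA.upper x _

theorem IsDiffusionTensor.bilin_self_nonneg (hA : IsDiffusionTensor A lmin lmax)
    (G : Lp (E n) 2 (volume : Measure (E n))) : 0 ≤ hA.bilin G G :=
  (mul_nonneg hA.pos.le (sq_nonneg _)).trans (hA.le_bilin_self G)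

theorem IsDiffusionTensor.abs_bilin_le (hA : IsDiffusionTensor A lmin lmax)
    (G H : Lp (E n) 2 (volume : Measure (E n))) : |hA.bilin G H| ≤ lmax * ‖G‖ * ‖H‖ :=
  FracAniso.abs_bilin_le hA.bilin
    (fun _ _ => integral_congr_ae (ae_of_all _ fun x => hA.inner_symm x _ _))
    hA.bilin_self_nonneg hA.lmax_pos.le hA.bilin_self_le G H

end Tensor

/-! ### The anisotropic form on `H^s_Ω`, as the tensor form pulled back along the gradient. -/

section Form

variable {n : ℕ} [NeZero n] {s : ℝ} {Ω : Set (E n)} {A : E n → Matrix (Fin n) (Fin n) ℝ}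
  {lmin lmax : ℝ}

theorem anisoForm_eq (hs0 : 0 < s) (hs1 : s < 1) (hΩb : Bornology.IsBounded Ω)
    (hA : IsDiffusionTensor A lmin lmax) (u v : HsOmega s Ω) :
    anisoForm (fracWeight n s) (fracKernel n) A (u : L2 n) (v : L2 n) =
      hA.bilin (gradLp hs0 hs1 hΩb u) (gradLp hs0 hs1 hΩb v) := by
  rw [anisoForm, hA.bilin_apply]
  refine integral_congr_ae ?_
  filter_upwards [coeFn_gradLp hs0 hs1 hΩb u, coeFn_gradLp hs0 hs1 hΩb v] with x h1 h2
  rw [formIntegrand, h1, h2]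

theorem integrable_formIntegrand (hs0 : 0 < s) (hs1 : s < 1) (hΩb : Bornology.IsBounded Ω)
    (hA : IsDiffusionTensor A lmin lmax) {u v : L2 n} (hu : u ∈ HsOmega s Ω)
    (hv : v ∈ HsOmega s Ω) :
    Integrable (formIntegrand (fracWeight n s) (fracKernel n) A u v) :=
  hA.integrable_inner (memLp_fracGrad hs0 hs1 hΩb hu).1 (memLp_fracGrad hs0 hs1 hΩb hv).1

theorem anisoEnergy_eq (hs0 : 0 < s) (hs1 : s < 1) (hΩb : Bornology.IsBounded Ω)
    (hA : IsDiffusionTensor A lmin lmax) (u : HsOmega s Ω) :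
    anisoEnergy (fracWeight n s) (fracKernel n) A (u : L2 n) =
      ENNReal.ofReal (hA.bilin (gradLp hs0 hs1 hΩb u) (gradLp hs0 hs1 hΩb u)) := by
  rw [← anisoForm_eq, anisoForm, ofReal_integral_eq_lintegral_ofReal
    (integrable_formIntegrand hs0 hs1 hΩb hA u.2 u.2)]
  · rfl
  · exact ae_of_all _ fun x => (mul_nonneg hA.pos.le (sq_nonneg _)).trans (hA.lower x _)

theorem anisoEnergyNorm_eq (hs0 : 0 < s) (hs1 : s < 1) (hΩb : Bornology.IsBounded Ω)
    (hA : IsDiffusionTensor A lmin lmax) (u : HsOmega s Ω) :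
    anisoEnergyNorm (fracWeight n s) (fracKernel n) A (u : L2 n) =
      √(hA.bilin (gradLp hs0 hs1 hΩb u) (gradLp hs0 hs1 hΩb u)) := by
  rw [anisoEnergyNorm, anisoEnergy_eq hs0 hs1 hΩb hA,
    ENNReal.toReal_ofReal (hA.bilin_self_nonneg _)]

theorem energySpace_eq (hs0 : 0 < s) (hs1 : s < 1) (hΩb : Bornology.IsBounded Ω)
    (hA : IsDiffusionTensor A lmin lmax) :
    energySpace (fracWeight n s) (fracKernel n) A Ω = HsOmega s Ω := by
  ext v
  constructor
  · rintro ⟨⟨G, hG⟩, -, hv⟩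
    exact ⟨hG.gagliardo_lt_top hs0 hs1 (measurable_coe_L2 v) (integrable_of_ae_eq_zero hΩb hv)
      (Lp.memLp v), hv⟩
  · intro hv
    have hv : v ∈ HsOmega s Ω := hv
    refine ⟨⟨_, isWeightedGradient_fracGrad hs0 hs1 hΩb hv⟩, ?_, hv.2⟩
    rw [anisoEnergy_eq hs0 hs1 hΩb hA ⟨v, hv⟩]
    exact ENNReal.ofReal_lt_top

theorem hsOmegaNorm_sq {n : ℕ} (v : L2 n) : hsOmegaNorm s v ^ 2 = (gagliardo s v).toReal :=
  Real.sq_sqrt ENNReal.toReal_nonneg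

theorem norm_gradLp_sq' (hs0 : 0 < s) (hs1 : s < 1) (hΩb : Bornology.IsBounded Ω)
    (u : HsOmega s Ω) :
    ‖gradLp hs0 hs1 hΩb u‖ ^ 2 = Cns n s / 2 * hsOmegaNorm s (u : L2 n) ^ 2 := by
  rw [norm_gradLp_sq, hsOmegaNorm_sq]

theorem norm_gradLp (hs0 : 0 < s) (hs1 : s < 1) (hΩb : Bornology.IsBounded Ω)
    (u : HsOmega s Ω) :
    ‖gradLp hs0 hs1 hΩb u‖ = √(Cns n s / 2) * hsOmegaNorm s (u : L2 n) := by
  have hC := Cns_pos n hs0 hs1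
  rw [← Real.sqrt_sq (norm_nonneg (gradLp hs0 hs1 hΩb u)), norm_gradLp_sq',
    Real.sqrt_mul (by positivity),
    Real.sqrt_sq (show 0 ≤ hsOmegaNorm s (u : L2 n) from Real.sqrt_nonneg _)]

/-- A vanishing gradient has zero seminorm by the norm identity, and Poincaré then gives zero `L²`
norm. -/
theorem injective_gradLp (hs0 : 0 < s) (hs1 : s < 1) (hΩb : Bornology.IsBounded Ω) :
    Function.Injective (gradLp (Ω := Ω) hs0 hs1 hΩb) := by
  rw [injective_iff_map_eq_zero]
  intro u hu
  have hC := Cns_pos n hs0 hs1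
  obtain ⟨c, hc, hP⟩ := exists_norm_sq_le_gagliardo (n := n) (Ω := Ω) hs0 hΩb
  have h := norm_gradLp_sq hs0 hs1 hΩb u
  rw [hu, norm_zero, zero_pow two_ne_zero, zero_eq_mul] at h
  have h0 := h.resolve_left (by positivity)
  have h1 := hP u u.2
  rw [h0, mul_zero] at h1
  have h2 : ‖(u : L2 n)‖ = 0 := by nlinarith [norm_nonneg (u : L2 n)]
  exact Subtype.ext (norm_eq_zero.1 h2)

/-- The three well-posedness statements share this existence and uniqueness, since each norm is at
most a constant times `hsOmegaNorm`; they differ only in the stability bound. -/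
theorem existsUnique_anisoForm_eq (hs0 : 0 < s) (hs1 : s < 1) (hΩb : Bornology.IsBounded Ω)
    (hA : IsDiffusionTensor A lmin lmax) (F : HsOmega s Ω →ₗ[ℝ] ℝ) {M : ℝ}
    (hF : ∀ v : HsOmega s Ω, |F v| ≤ M * hsOmegaNorm s (v : L2 n)) :
    ∃ u : HsOmega s Ω,
      (∀ v : HsOmega s Ω, anisoForm (fracWeight n s) (fracKernel n) A (u : L2 n) (v : L2 n) = F v) ∧
      ∀ u' : HsOmega s Ω, (∀ v : HsOmega s Ω,
        anisoForm (fracWeight n s) (fracKernel n) A (u' : L2 n) (v : L2 n) = F v) → u' = u := by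
  have hC := Cns_pos n hs0 hs1
  have hsq : 0 < √(Cns n s / 2) := Real.sqrt_pos.2 (by positivity)
  simp only [anisoForm_eq hs0 hs1 hΩb hA]
  refine existsUnique_of_coercive (gradLp hs0 hs1 hΩb) (injective_gradLp hs0 hs1 hΩb)
    (isClosed_range_gradLp hs0 hs1 hΩb) (hA.bilin.mkContinuous₂ lmax hA.abs_bilin_le) hA.pos
    (fun G => ?_) F (M := M * (√(Cns n s / 2))⁻¹) fun v => ?_
  · rw [mul_assoc, ← sq]
    exact hA.le_bilin_self G
  · rw [norm_gradLp, mul_assoc, inv_mul_cancel_left₀ hsq.ne']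
    exact hF v

end Form

end

end

end FracAniso

/-! ### Assembly of the theorem. -/

open FracAniso in
theorem lemma3p6 (n : ℕ) [NeZero n] (s : ℝ) (hs0 : 0 < s) (hs1 : s < 1)
    (Ω : Set (E n)) (hΩ : IsOpen Ω) (hΩb : Bornology.IsBounded Ω) :
    -- weighted gradients exist on `H^s_Ω`, lie in `L²`, and are given by the integral formula at
    -- almost every point at which the integral converges absolutely
    (∀ u ∈ HsOmega s Ω,
      IsWeightedGradient (fracWeight n s) (fracKernel n) u
        (weightedGradient (fracWeight n s) (fracKernel n) u) ∧
      MemLp (weightedGradient (fracWeight n s) (fracKernel n) u) 2 volume ∧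
      ∀ᵐ x, Integrable (fun y => (fracWeight n s x y * (u y - u x)) • fracKernel n x y) →
        weightedGradient (fracWeight n s) (fracKernel n) u x =
          ∫ y, (fracWeight n s x y * (u y - u x)) • fracKernel n x y) ∧
    -- the two norms of `H^s_Ω` are equivalent, with a constant that depends on `n, s, Ω` only
    ∃ K : ℝ, 0 < K ∧ (∀ u ∈ HsOmega s Ω, hsNorm s u ≤ K * hsOmegaNorm s u) ∧
    ∀ (A : E n → Matrix (Fin n) (Fin n) ℝ) (lmin lmax : ℝ), IsDiffusionTensor A lmin lmax →
      -- the form is a well-defined bilinear form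
      (∀ u ∈ HsOmega s Ω, ∀ v ∈ HsOmega s Ω,
        Integrable (formIntegrand (fracWeight n s) (fracKernel n) A u v)) ∧
      (∃ b : HsOmega s Ω →ₗ[ℝ] HsOmega s Ω →ₗ[ℝ] ℝ, ∀ u v : HsOmega s Ω,
        b u v = anisoForm (fracWeight n s) (fracKernel n) A u v) ∧
      -- continuity
      (∀ u ∈ HsOmega s Ω, ∀ v ∈ HsOmega s Ω,
        |anisoForm (fracWeight n s) (fracKernel n) A u v| ≤
          Cns n s / 2 * lmax * hsOmegaNorm s u * hsOmegaNorm s v) ∧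
      -- coercivity
      0 < Cns n s / 2 * lmin ∧
      (∀ u ∈ HsOmega s Ω,
        Cns n s / 2 * lmin * hsOmegaNorm s u ^ 2 ≤
          anisoForm (fracWeight n s) (fracKernel n) A u u) ∧
      -- well-posedness of the weak problem in `V^A_Ω = H^s_Ω`, in each of the three norms
      energySpace (fracWeight n s) (fracKernel n) A Ω = HsOmega s Ω ∧
      WellPosed (HsOmega s Ω) (anisoEnergyNorm (fracWeight n s) (fracKernel n) A)
        (fun u v => anisoForm (fracWeight n s) (fracKernel n) A u v) 1 ∧
      WellPosed (HsOmega s Ω) (hsOmegaNorm s)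
        (fun u v => anisoForm (fracWeight n s) (fracKernel n) A u v) (Cns n s / 2 * lmin)⁻¹ ∧
      WellPosed (HsOmega s Ω) (hsNorm s)
        (fun u v => anisoForm (fracWeight n s) (fracKernel n) A u v)
        (K ^ 2 * (Cns n s / 2 * lmin)⁻¹) := by
  obtain ⟨c, hc, hP⟩ := exists_norm_sq_le_gagliardo (n := n) (Ω := Ω) hs0 hΩb
  have hC := Cns_pos n hs0 hs1
  -- The constant `K = √(c + 1)` comes from the Poincaré constant `c`, which involves no tensor `A`.
  have hnorm : ∀ u ∈ HsOmega s Ω, hsNorm s u ≤ √(c + 1) * hsOmegaNorm s u := by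
    intro u hu
    rw [hsNorm, hsOmegaNorm, ← Real.sqrt_mul (by positivity)]
    refine Real.sqrt_le_sqrt ?_
    rw [add_mul, one_mul]
    exact add_le_add_left (hP u hu) _
  refine ⟨fun u hu => ⟨isWeightedGradient_fracGrad hs0 hs1 hΩb hu,
    (memLp_fracGrad hs0 hs1 hΩb hu).1,
    (isWeightedGradient_fracGrad hs0 hs1 hΩb hu).ae_eq_integral hs0 hs1
      (integrable_of_ae_eq_zero hΩb hu.2)⟩,
    √(c + 1), by positivity, hnorm, fun A lmin lmax hA => ?_⟩
  set T := gradLp (Ω := Ω) hs0 hs1 hΩb with hT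
  have hcoer : 0 < Cns n s / 2 * lmin := mul_pos (by positivity) hA.pos
  have hlow : ∀ u : HsOmega s Ω, Cns n s / 2 * lmin * hsOmegaNorm s (u : L2 n) ^ 2 ≤
      anisoForm (fracWeight n s) (fracKernel n) A (u : L2 n) (u : L2 n) := by
    intro u
    rw [anisoForm_eq hs0 hs1 hΩb hA]
    refine le_trans (le_of_eq ?_) (hA.le_bilin_self _)
    rw [norm_gradLp_sq']
    ring
  have hO : ∀ u : L2 n, 0 ≤ hsOmegaNorm s u := fun u => Real.sqrt_nonneg _
  refine ⟨fun u hu v hv => integrable_formIntegrand hs0 hs1 hΩb hA hu hv,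
    ⟨(hA.bilin.comp T).compl₂ T, fun u v => (anisoForm_eq hs0 hs1 hΩb hA u v).symm⟩,
    fun u hu v hv => ?_, hcoer, fun u hu => hlow ⟨u, hu⟩, energySpace_eq hs0 hs1 hΩb hA,
    fun F M hM hF => ?_, fun F M hM hF => ?_, fun F M hM hF => ?_⟩
  · rw [anisoForm_eq hs0 hs1 hΩb hA ⟨u, hu⟩ ⟨v, hv⟩]
    refine (hA.abs_bilin_le _ _).trans_eq ?_
    rw [norm_gradLp, norm_gradLp]
    have := Real.mul_self_sqrt (show 0 ≤ Cns n s / 2 by positivity)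
    calc _ = (√(Cns n s / 2) * √(Cns n s / 2)) * lmax * hsOmegaNorm s u * hsOmegaNorm s v := by
          ring
      _ = _ := by rw [this]
  · have hN := anisoEnergyNorm_eq hs0 hs1 hΩb hA
    have hNle : ∀ v : HsOmega s Ω, anisoEnergyNorm (fracWeight n s) (fracKernel n) A (v : L2 n) ≤
        √(lmax * (Cns n s / 2)) * hsOmegaNorm s (v : L2 n) := by
      intro v
      have hl := hA.lmax_pos
      rw [hN, ← Real.sqrt_sq (hO v), ← Real.sqrt_mul (by positivity)]
      refine Real.sqrt_le_sqrt ((hA.bilin_self_le _).trans_eq ?_)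
      rw [norm_gradLp_sq', mul_assoc]
    obtain ⟨u, hu, huniq⟩ := existsUnique_anisoForm_eq hs0 hs1 hΩb hA F
      (M := M * √(lmax * (Cns n s / 2))) fun v => (hF v).trans (by
        rw [mul_assoc]
        exact mul_le_mul_of_nonneg_left (hNle v) hM)
    refine ⟨u, hu, huniq, ?_⟩
    -- Testing with `u` gives `|||u|||² = F u ≤ M |||u|||`, and one factor is divided out unless it
    -- is zero.
    have h1 := (le_abs_self _).trans (hF u)
    rw [← hu u, anisoForm_eq hs0 hs1 hΩb hA, ← Real.sq_sqrt (hA.bilin_self_nonneg _), ← hN,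
      sq] at h1
    rw [one_mul]
    rcases (show 0 ≤ anisoEnergyNorm (fracWeight n s) (fracKernel n) A (u : L2 n) from
      Real.sqrt_nonneg _).eq_or_lt with h0 | h0
    · rw [← h0]; exact hM
    · exact le_of_mul_le_mul_right h1 h0
  · obtain ⟨u, hu, huniq⟩ := existsUnique_anisoForm_eq hs0 hs1 hΩb hA F hF
    refine ⟨u, hu, huniq, ?_⟩
    have h1 := (hlow u).trans ((hu u).trans_le ((le_abs_self _).trans (hF u)))
    rw [inv_mul_eq_div, le_div_iff₀' hcoer]
    rcases (hO u).eq_or_lt with h0 | h0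
    · rw [← h0, mul_zero]; exact hM
    · rw [sq, ← mul_assoc] at h1
      exact le_of_mul_le_mul_right h1 h0
  · have hF' : ∀ v : HsOmega s Ω, |F v| ≤ M * √(c + 1) * hsOmegaNorm s (v : L2 n) := fun v =>
      (hF v).trans (by
        rw [mul_assoc]
        exact mul_le_mul_of_nonneg_left (hnorm v v.2) hM)
    obtain ⟨u, hu, huniq⟩ := existsUnique_anisoForm_eq hs0 hs1 hΩb hA F hF'
    refine ⟨u, hu, huniq, (hnorm u u.2).trans ?_⟩
    have h1 := (hlow u).trans ((hu u).trans_le ((le_abs_self _).trans (hF' u)))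
    have h2 : hsOmegaNorm s (u : L2 n) ≤ (Cns n s / 2 * lmin)⁻¹ * (M * √(c + 1)) := by
      rw [inv_mul_eq_div, le_div_iff₀' hcoer]
      rcases (hO u).eq_or_lt with h0 | h0
      · rw [← h0, mul_zero]; positivity
      · rw [sq, ← mul_assoc] at h1
        exact le_of_mul_le_mul_right h1 h0
    -- One factor `K` comes from bounding `F` in `hsOmegaNorm`, the other from returning to the full
    -- norm of `u`.
    calc √(c + 1) * hsOmegaNorm s (u : L2 n)
        ≤ √(c + 1) * ((Cns n s / 2 * lmin)⁻¹ * (M * √(c + 1))) := by gcongr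
      _ = _ := by ring
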